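/- Let $H\in(\tfrac12,1)$, let $m\in\mathbb N$ satisfy $H^*(m):=m(H-1)+1<0$, and let $B=(B_t)_{t\in\mathbb R}$ be a two-sided fractional Brownian motion with Hurst parameter $H$, i.e. a centred Gaussian process with $\mathbb E(B_sB_t)=\tfrac12(|s|^{2H}+|t|^{2H}-|t-s|^{2H})$, on a probability space $(\Omega,\mathcal F,\mathbb P)$. Let $\mathcal F_k=\sigma(B_r: r\le k)$, and let $$y_t=\sigma\int_{-\infty}^t e^{-(t-s)}\,dB_s ,\qquad t\in\mathbb R,$$ be the stationary fractional Ornstein--Uhlenbeck process (the integral being a mean-square Riemann--Stieltjes integral), where $\sigma$ is chosen such that $y_t\sim N(0,1)$. (i) For all real $k\ge 0$ and $t\in\mathbb R$ there is an almost surely unique decomposition $y_t=\bar y^k_t+\tilde y^k_t$ in which $\bar y^k_t$ is a centred, square integrable, $\mathcal F_k$-measurable (up to null sets) random variable and $\tilde y^k_t$ is independent of $\mathcal F_k$. (ii) The measurable parts $\bar y^k_t$ satisfy $$\sup_{k\ge 0}\ \sup_{q\in\mathbb N,\ q\ge m}\ \int_{k-1}^{\infty}\int_{k-1}^{\infty}\bigl(\mathbb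 E(\bar y^k_s\,\bar y^k_t)\bigr)^q\,dt\,ds<\infty ,$$ where for all such $k$ and $q$ the integrand is integrable on $(k-1,\infty)^2$. (iii) Let $H_n$ be the monic Hermite polynomials, orthogonal in $L^2(N(0,1))$, and let $U\in L^2(N(0,1))$ have Hermite rank $m$, i.e. $m$ is the smallest index $n$ with $\int U H_n\,dN(0,1)\neq 0$. Then, for every $k\ge 0$, the function $r\mapsto\mathbb E(U(y_r)\mid\mathcal F_k)\in L^2(\mathbb P)$ is Bochner integrable on $(k-1,\infty)$, and the martingale correctors $$\hat U(k)=\int_{k-1}^\infty \mathbb E\bigl(U(y_r)\mid\mathcal F_k\bigr)\,dr$$ are bounded in $L^2$: $\ \sup_{k\ge0}\|\hat U(k)\|_{L^2(\mathbb P)}<\infty$. -/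

import Mathlib

open MeasureTheory ProbabilityTheory Filter Topology Set

/-- The exponent `H*(m) = m (H - 1) + 1`. -/
noncomputable def hStar (H : ℝ) (m : ℕ) : ℝ := m * (H - 1) + 1

/-- `B` is a two-sided fractional Brownian motion with Hurst parameter `H`: a centred Gaussian
process indexed by `ℝ` with `E (B_s B_t) = (|s|^{2H} + |t|^{2H} - |t - s|^{2H}) / 2`.
In particular `B_0 = 0` almost surely and `E (B_1)^2 = 1`. -/
structure IsFractionalBM {Ω : Type*} [MeasurableSpace Ω] (P : Measure Ω) (H : ℝ)
    (B : ℝ → Ω → ℝ) : Prop where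
  measurable : ∀ t, Measurable (B t)
  gaussian : IsGaussianProcess B P
  centred : ∀ t, ∫ ω, B t ω ∂P = 0
  covariance : ∀ s t, ∫ ω, B s ω * B t ω ∂P
    = (|s| ^ (2 * H) + |t| ^ (2 * H) - |t - s| ^ (2 * H)) / 2

/-- The filtration `F_k = σ(B_r : r ≤ k)` generated by the process `B`. -/
@[reducible] def pastSigma {Ω : Type*} (B : ℝ → Ω → ℝ) (k : ℝ) : MeasurableSpace Ω :=
  ⨆ r : Iic k, MeasurableSpace.comap (B r) inferInstance

/-- `J` is the mean-square Riemann–Stieltjes (Wiener) integral `∫_a^b f dX`: the limit in `L²(P)`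
of the sums `∑ f(c_i) (X_{p_{i+1}} - X_{p_i})` over the tagged partitions
`a = p_0 ≤ c_0 ≤ p_1 ≤ ⋯ ≤ p_n = b`, as the mesh tends to zero. -/
def HasMeanSquareIntegral {Ω : Type*} [MeasurableSpace Ω] (P : Measure Ω) (f : ℝ → ℝ)
    (X : ℝ → Ω → ℝ) (a b : ℝ) (J : Ω → ℝ) : Prop :=
  MemLp J 2 P ∧ ∀ ε : ℝ, 0 < ε → ∃ δ : ℝ, 0 < δ ∧ ∀ (n : ℕ) (p c : ℕ → ℝ),
    p 0 = a → p n = b →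
    (∀ i < n, p i ≤ c i ∧ c i ≤ p (i + 1) ∧ p (i + 1) - p i < δ) →
    eLpNorm (fun ω => (∑ i ∈ Finset.range n, f (c i) * (X (p (i + 1)) ω - X (p i) ω)) - J ω) 2 P
      < ENNReal.ofReal ε

/-- `J` is the mean-square integral `∫_{-∞}^b f dX`, the limit in `L²(P)` of `∫_a^b f dX`
as `a → -∞`. -/
def HasMeanSquareIntegralIic {Ω : Type*} [MeasurableSpace Ω] (P : Measure Ω) (f : ℝ → ℝ)
    (X : ℝ → Ω → ℝ) (b : ℝ) (J : Ω → ℝ) : Prop :=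
  MemLp J 2 P ∧ ∃ I : ℝ → Ω → ℝ, (∀ a < b, HasMeanSquareIntegral P f X a b (I a)) ∧
    Tendsto (fun a => eLpNorm (fun ω => I a ω - J ω) 2 P) atBot (𝓝 0)

/-- `y` is (a version of) the stationary fractional Ornstein–Uhlenbeck process
`y_t = σ ∫_{-∞}^t e^{-(t-s)} dB_s` driven by `B`, where the constant `σ` is such that `y_t` has
the standard Gaussian distribution. -/
structure IsStationaryFOU {Ω : Type*} [MeasurableSpace Ω] (P : Measure Ω) (B : ℝ → Ω → ℝ)
    (σ : ℝ) (y : ℝ → Ω → ℝ) : Prop where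
  integral_eq : ∀ t, ∃ J : Ω → ℝ,
    HasMeanSquareIntegralIic P (fun s => Real.exp (-(t - s))) B t J ∧
    y t =ᵐ[P] fun ω => σ * J ω
  law : ∀ t, HasLaw (y t) (gaussianReal 0 1) P

/-- The local independent decomposition `Y = Ybar + Ytil` of a random variable `Y` relative to a
sub-σ-algebra `F`: `Ybar` is a centred square integrable random variable which is
`F`-measurable (up to null sets), and `Ytil` is independent of `F`. -/
structure IsLocalIndepDecomposition {Ω : Type*} [mΩ : MeasurableSpace Ω] (P : Measure Ω)
    (F : MeasurableSpace Ω) (Y Ybar Ytil : Ω → ℝ) : Prop where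
  add_eq : Y =ᵐ[P] fun ω => Ybar ω + Ytil ω
  past_measurable : AEStronglyMeasurable[F] Ybar P
  past_memLp : MemLp Ybar 2 P
  past_centred : ∫ ω, Ybar ω ∂P = 0
  future_measurable : Measurable[mΩ] Ytil
  future_indep : Indep (MeasurableSpace.comap Ytil inferInstance) F P

/-- The Hermite coefficient `c_n = ⟨U, H_n⟩ / n!` of `U ∈ L²(N(0,1))`, where `H_n` is the monic
(probabilists') Hermite polynomial of degree `n`. -/
noncomputable def hermiteCoeff (U : ℝ → ℝ) (n : ℕ) : ℝ :=
  (∫ x, U x * Polynomial.aeval x (Polynomial.hermite n) ∂(gaussianReal 0 1)) / n.factorial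

/-- `m` is the Hermite rank of `U`: the smallest index with a nonzero Hermite coefficient. -/
def HasHermiteRank (U : ℝ → ℝ) (m : ℕ) : Prop :=
  hermiteCoeff U m ≠ 0 ∧ ∀ j < m, hermiteCoeff U j = 0

open Classical in
/-- The conditional expectation `E(Z | F)` as an element of `L²(P)` (and `0` if it is not square
integrable). -/
noncomputable def condExpLp {Ω : Type*} [MeasurableSpace Ω] (P : Measure Ω)
    (F : MeasurableSpace Ω) (Z : Ω → ℝ) : Lp ℝ 2 P :=
  if h : MemLp (P[Z | F]) 2 P then h.toLp (P[Z | F]) else 0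

/-- The martingale corrector `Û(k) = ∫_{k-1}^∞ E(U(y_r) | F_k) dr`, a Bochner integral
in `L²(P)`. -/
noncomputable def corrector {Ω : Type*} [MeasurableSpace Ω] (P : Measure Ω) (B y : ℝ → Ω → ℝ)
    (U : ℝ → ℝ) (k : ℝ) : Lp ℝ 2 P :=
  ∫ r in Ioi (k - 1), condExpLp P (pastSigma B k) (fun ω => U (y r ω))

/-! The proof takes place in the Gaussian Hilbert space, the closed span of $B$ in $L^2(P)$. The
measurable part of $y_t$ is the orthogonal projection $z$ of $y_t$ onto the closed span of
$(B_r)_{r\le k}$. The remainder is orthogonal to the past, hence independent of it by Gaussianity.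
Uniqueness holds because the measurable part of any such decomposition is $E(y_t\mid\mathcal F_k)$.

The analytic core is the decay $\|z\|\le C(t-k)^{H-1}$ for $t\ge k+1$
(`IsFractionalBM.exists_norm_starProjection_le`). Since $\|z\|^2=\langle y_t,z\rangle$, it suffices
to bound correlations of $y_t$ with the past. Up to a constant, $B$ has the same covariances as the
kernels $(t+u)_+^\alpha-u_+^\alpha$ in $L^2(\mathbb R)$, $\alpha=H-\tfrac12$. There Cauchy–Schwarz
bounds the correlation of an increment over $[p,q]$ with a past vector $x$ by
$C(q-p)(p-k)^{H-1}\|x\|$. Summing over Riemann sums transfers this to $y$.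

For the correctors put $\rho=\|z\|$ and $z=\rho x$ with $x$ standard Gaussian. Mehler's formula
gives $E(H_n(y_t)\mid\mathcal F_k)=\rho^nH_n(x)$, so conditioning is diagonal in the Hermite basis
and contracts functions of Hermite rank $m$ by $\rho^m$ (`IsFractionalBM.norm_condExpComp_le`). The
condition $H^*(m)<0$ says $m(H-1)<-1$, so $\rho^m$ is integrable in $t$, with a bound depending only
on $t-k$. This yields both uniform estimates. -/

open scoped InnerProductSpace

/-! ### Mandelbrot–Van Ness kernels in $L^2(\mathbb R)$ -/

/-- The increment over `[p, q]` of the (time-reversed) Mandelbrot–Van Ness kernel. -/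
noncomputable def mvnIncrement (α p q u : ℝ) : ℝ := (max (q + u) 0) ^ α - (max (p + u) 0) ^ α

namespace mvnIncrement

variable {α p q u : ℝ}

lemma nonneg (hα : 0 < α) (hpq : p ≤ q) : 0 ≤ mvnIncrement α p q u := by
  unfold mvnIncrement
  have : (max (p + u) 0) ^ α ≤ (max (q + u) 0) ^ α :=
    Real.rpow_le_rpow (le_max_right _ _) (max_le_max (by linarith) le_rfl) hα.le
  linarith

lemma eq_zero (hpq : p ≤ q) (hu : u ≤ -q) : mvnIncrement α p q u = 0 := by
  unfold mvnIncrement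
  rw [max_eq_right (by linarith), max_eq_right (by linarith), sub_self]

/-- Bernoulli's inequality $(1+s)^\alpha\le1+\alpha s$ with $s=(q-p)/(p+u)$. -/
lemma le_mul_rpow (hα : 0 < α) (hα1 : α ≤ 1) (hpq : p ≤ q) (hu : -p < u) :
    mvnIncrement α p q u ≤ α * (q - p) * (p + u) ^ (α - 1) := by
  have h0 : 0 < p + u := by linarith
  unfold mvnIncrement
  rw [max_eq_left (by linarith), max_eq_left h0.le]
  have h1 : q + u = (p + u) * (1 + (q - p) / (p + u)) := by field_simp; ring
  have hs : 0 ≤ (q - p) / (p + u) := div_nonneg (by linarith) h0.le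
  have h2 : (1 + (q - p) / (p + u)) ^ α ≤ 1 + α * ((q - p) / (p + u)) :=
    rpow_one_add_le_one_add_mul_self (by linarith) hα.le hα1
  rw [h1, Real.mul_rpow h0.le (by linarith), Real.rpow_sub_one h0.ne']
  have h3 := mul_le_mul_of_nonneg_left h2 (Real.rpow_nonneg h0.le α)
  calc _ ≤ (p + u) ^ α * (1 + α * ((q - p) / (p + u))) - (p + u) ^ α := by linarith
    _ = _ := by field_simp; ring

lemma continuous (hα : 0 < α) : Continuous (mvnIncrement α p q) := by
  unfold mvnIncrement
  refine Continuous.sub ?_ ?_ <;>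
  exact Continuous.rpow_const (by fun_prop) (fun _ => Or.inr hα.le)

lemma sq_le_tail (hα : 0 < α) (hα1 : α ≤ 1) (hpq : p ≤ q) (hu : -p < u) :
    mvnIncrement α p q u ^ 2 ≤ (α * (q - p)) ^ 2 * (p + u) ^ (2 * α - 2) := by
  have h0 : 0 < p + u := by linarith
  calc _ ≤ (α * (q - p) * (p + u) ^ (α - 1)) ^ 2 :=
        pow_le_pow_left₀ (nonneg hα hpq) (le_mul_rpow hα hα1 hpq hu) 2
    _ = _ := by
      rw [mul_pow, ← Real.rpow_natCast ((p + u) ^ (α - 1)), ← Real.rpow_mul h0.le]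
      norm_num [sub_mul, mul_comm]

lemma integrableOn_tail (hα2 : α < 1 / 2) {k : ℝ} (hk : k < p) :
    IntegrableOn (fun u => (p + u) ^ (2 * α - 2)) (Ioi (-k)) := by
  have h := (integrableOn_Ioi_rpow_iff (s := 2 * α - 2) (t := p - k) (by linarith)).2 (by linarith)
  have h2 := (measurePreserving_add_left (volume : Measure ℝ) p).integrableOn_comp_preimage
    (measurableEmbedding_addLeft p) (s := Ioi (p - k)) (f := fun x => x ^ (2 * α - 2))
  have h3 : (fun x => p + x) ⁻¹' (Ioi (p - k)) = Ioi (-k) := by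
    ext x; simp only [mem_preimage, mem_Ioi]; constructor <;> intro h <;> linarith
  rw [h3] at h2
  exact h2.2 h

lemma integral_tail (hα2 : α < 1 / 2) {k : ℝ} (hk : k < p) :
    ∫ u in Ioi (-k), (p + u) ^ (2 * α - 2) = (p - k) ^ (2 * α - 1) / (1 - 2 * α) := by
  have h2 := (measurePreserving_add_left (volume : Measure ℝ) p).setIntegral_preimage_emb
    (measurableEmbedding_addLeft p) (fun x => x ^ (2 * α - 2)) (Ioi (p - k))
  have h3 : (fun x => p + x) ⁻¹' (Ioi (p - k)) = Ioi (-k) := by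
    ext x; simp only [mem_preimage, mem_Ioi]; constructor <;> intro h <;> linarith
  rw [h3] at h2
  rw [h2, integral_Ioi_rpow_of_lt (by linarith) (by linarith)]
  rw [show (2 * α - 2 + 1 : ℝ) = -(1 - 2 * α) by ring, div_neg, neg_div, neg_neg]
  congr 2; ring

lemma integrable_sq (hα : 0 < α) (hα2 : α < 1 / 2) (hpq : p ≤ q) :
    Integrable (fun u => mvnIncrement α p q u ^ 2) := by
  have hc : Continuous (fun u => mvnIncrement α p q u ^ 2) := (continuous hα).pow 2
  have h1 : IntegrableOn (fun u => mvnIncrement α p q u ^ 2) (Iic (-q)) := by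
    refine integrableOn_zero.congr_fun (fun u hu => ?_) measurableSet_Iic
    simp [eq_zero hpq hu]
  have h2 : IntegrableOn (fun u => mvnIncrement α p q u ^ 2) (Icc (-q) (-(p - 1))) :=
    hc.continuousOn.integrableOn_Icc
  have h3 : IntegrableOn (fun u => mvnIncrement α p q u ^ 2) (Ioi (-(p - 1))) := by
    refine Integrable.mono' ((integrableOn_tail hα2 (by linarith : p - 1 < p)).const_mul
      ((α * (q - p)) ^ 2)) hc.aestronglyMeasurable ?_
    filter_upwards [ae_restrict_mem measurableSet_Ioi] with u hu
    rw [Real.norm_of_nonneg (sq_nonneg _)]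
    exact sq_le_tail hα (by linarith) hpq (by rw [mem_Ioi] at hu; linarith)
  rw [← integrableOn_univ]
  refine ((h1.union h2).union h3).mono_set (fun u _ => ?_)
  by_cases hu : u ≤ -q
  · exact Or.inl (Or.inl hu)
  · by_cases hu' : u ≤ -(p - 1)
    · exact Or.inl (Or.inr ⟨(not_le.1 hu).le, hu'⟩)
    · exact Or.inr (not_le.1 hu')

lemma memLp (hα : 0 < α) (hα2 : α < 1 / 2) (p q : ℝ) : MemLp (mvnIncrement α p q) 2 := by
  rcases le_total p q with h | h
  · exact (memLp_two_iff_integrable_sq (continuous hα).aestronglyMeasurable).2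
      (integrable_sq hα hα2 h)
  · have := ((memLp_two_iff_integrable_sq (continuous (p := q) (q := p) hα).aestronglyMeasurable).2
      (integrable_sq hα hα2 h)).neg
    refine this.congr_norm (continuous hα).aestronglyMeasurable (ae_of_all _ fun u => ?_)
    simp [mvnIncrement]

/-- The total mass of the squared unit increment. -/
noncomputable def mass (α : ℝ) : ℝ := ∫ u, mvnIncrement α 0 1 u ^ 2

lemma mass_pos (hα : 0 < α) (hα2 : α < 1 / 2) : 0 < mass α := by
  have hc : Continuous (fun u => mvnIncrement α 0 1 u ^ 2) := (continuous hα).pow 2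
  refine (integral_pos_iff_support_of_nonneg (fun u => sq_nonneg _)
    (integrable_sq hα hα2 zero_le_one)).2 ?_
  refine (hc.isOpen_support).measure_pos _ ⟨0, ?_⟩
  simp [mvnIncrement, Real.zero_rpow hα.ne']

/-- Homogeneity of the kernel under $u\mapsto -p+(q-p)u$: the squared integrand contributes the
exponent $2\alpha$ and the Jacobian contributes $1$. -/
lemma integral_sq_of_le (hα : 0 < α) (hpq : p ≤ q) :
    ∫ u, mvnIncrement α p q u ^ 2 = (q - p) ^ (2 * α + 1) * mass α := by
  rcases hpq.eq_or_lt with rfl | hlt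
  · simp [mvnIncrement, Real.zero_rpow (by linarith : 2 * α + 1 ≠ 0)]
  have h0 : 0 < q - p := by linarith
  have hs : ∀ u, mvnIncrement α p q (-p + (q - p) * u) ^ 2
      = (q - p) ^ (2 * α) * mvnIncrement α 0 1 u ^ 2 := by
    intro u
    have h1 : max (q + (-p + (q - p) * u)) 0 = (q - p) * max (1 + u) 0 := by
      rw [mul_max_of_nonneg _ _ h0.le, mul_zero]; congr 1; ring
    have h2 : max (p + (-p + (q - p) * u)) 0 = (q - p) * max (0 + u) 0 := by
      rw [mul_max_of_nonneg _ _ h0.le, mul_zero]; congr 1; ring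
    unfold mvnIncrement
    rw [h1, h2, Real.mul_rpow h0.le (le_max_right _ _), Real.mul_rpow h0.le (le_max_right _ _),
      ← mul_sub, mul_pow, ← Real.rpow_natCast ((q - p) ^ α), ← Real.rpow_mul h0.le]
    norm_num [mul_comm]
  have h1 := Measure.integral_comp_mul_left (fun u => mvnIncrement α p q (-p + u) ^ 2) (q - p)
  rw [integral_add_left_eq_self (fun u => mvnIncrement α p q u ^ 2) (-p)] at h1
  simp_rw [hs] at h1
  rw [integral_const_mul, abs_of_pos (inv_pos.2 h0), smul_eq_mul, eq_inv_mul_iff_mul_eq₀ h0.ne'] at h1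
  rw [← h1, Real.rpow_add_one h0.ne', mass]
  ring

lemma integral_sq (hα : 0 < α) (p q : ℝ) :
    ∫ u, mvnIncrement α p q u ^ 2 = |q - p| ^ (2 * α + 1) * mass α := by
  rcases le_total p q with h | h
  · rw [abs_of_nonneg (by linarith), integral_sq_of_le hα h]
  · rw [abs_sub_comm, abs_of_nonneg (by linarith), ← integral_sq_of_le hα h]
    congr 1; ext u; unfold mvnIncrement; ring

lemma setIntegral_sq_le (hα : 0 < α) (hα2 : α < 1 / 2) (hpq : p ≤ q) {k : ℝ} (hk : k < p) :
    ∫ u in Ioi (-k), mvnIncrement α p q u ^ 2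
      ≤ α ^ 2 / (1 - 2 * α) * (q - p) ^ 2 * (p - k) ^ (2 * α - 1) := by
  calc _ ≤ ∫ u in Ioi (-k), (α * (q - p)) ^ 2 * (p + u) ^ (2 * α - 2) := by
        refine setIntegral_mono_on (integrable_sq hα hα2 hpq).integrableOn
          ((integrableOn_tail hα2 hk).const_mul _) measurableSet_Ioi fun u hu => ?_
        exact sq_le_tail hα (by linarith) hpq (by rw [mem_Ioi] at hu; linarith)
    _ = _ := by rw [integral_const_mul, integral_tail hα2 hk]; ring

end mvnIncrement

/-- Families with proportional Gram matrices can be compared on formal linear combinations, so no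
map between the two spans need be constructed. This carries estimates from the kernels to $B$. -/
lemma inner_linearCombination_eq_mul {ι E F : Type*} [NormedAddCommGroup E] [InnerProductSpace ℝ E]
    [NormedAddCommGroup F] [InnerProductSpace ℝ F] {b : ι → E} {Φ : ι → F} {M : ℝ}
    (h : ∀ s t, ⟪Φ s, Φ t⟫_ℝ = M * ⟪b s, b t⟫_ℝ) (c d : ι →₀ ℝ) :
    ⟪Finsupp.linearCombination ℝ Φ c, Finsupp.linearCombination ℝ Φ d⟫_ℝ
      = M * ⟪Finsupp.linearCombination ℝ b c, Finsupp.linearCombination ℝ b d⟫_ℝ := by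
  simp only [Finsupp.linearCombination_apply, Finsupp.sum, sum_inner, inner_sum, real_inner_smul_left,
    real_inner_smul_right, h, Finset.mul_sum]
  refine Finset.sum_congr rfl fun i _ => Finset.sum_congr rfl fun j _ => by ring

/-- The Mandelbrot–Van Ness kernel as an element of `L²(ℝ)`. -/
noncomputable def mvnLp {α : ℝ} (hα : 0 < α) (hα2 : α < 1 / 2) (t : ℝ) :
    Lp ℝ 2 (volume : Measure ℝ) :=
  (mvnIncrement.memLp hα hα2 0 t).toLp _

section mvnLp

variable {α : ℝ} (hα : 0 < α) (hα2 : α < 1 / 2)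

lemma mvnLp_sub (p q : ℝ) :
    mvnLp hα hα2 q - mvnLp hα hα2 p = (mvnIncrement.memLp hα hα2 p q).toLp _ := by
  rw [mvnLp, mvnLp, ← MemLp.toLp_sub]
  congr 1
  ext u
  simp only [mvnIncrement, Pi.sub_apply]
  ring

lemma sq_norm_toLp_eq_integral {Ω : Type*} [MeasurableSpace Ω] {μ : Measure Ω} {f : Ω → ℝ}
    (hf : MemLp f 2 μ) : ‖hf.toLp f‖ ^ 2 = ∫ u, f u ^ 2 ∂μ := by
  rw [← real_inner_self_eq_norm_sq, L2.inner_def]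
  refine integral_congr_ae ?_
  filter_upwards [hf.coeFn_toLp] with u hu
  simp [hu, sq]

lemma inner_toLp_eq_integral {Ω : Type*} [MeasurableSpace Ω] {μ : Measure Ω} {f g : Ω → ℝ}
    (hf : MemLp f 2 μ) (hg : MemLp g 2 μ) :
    ⟪hf.toLp f, hg.toLp g⟫_ℝ = ∫ u, f u * g u ∂μ := by
  rw [L2.inner_def]
  refine integral_congr_ae ?_
  filter_upwards [hf.coeFn_toLp, hg.coeFn_toLp] with u hu hv
  simp [hu, hv, mul_comm]

lemma sq_norm_mvnLp_sub (p q : ℝ) :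
    ‖mvnLp hα hα2 q - mvnLp hα hα2 p‖ ^ 2 = |q - p| ^ (2 * α + 1) * mvnIncrement.mass α := by
  rw [mvnLp_sub, sq_norm_toLp_eq_integral, mvnIncrement.integral_sq hα]

/-- Polarization: the squared norms of the increments determine the inner products, because the
kernel at time $0$ vanishes. -/
lemma inner_mvnLp (s t : ℝ) : ⟪mvnLp hα hα2 s, mvnLp hα hα2 t⟫_ℝ = mvnIncrement.mass α *
    ((|s| ^ (2 * α + 1) + |t| ^ (2 * α + 1) - |t - s| ^ (2 * α + 1)) / 2) := by
  have h0 : mvnLp hα hα2 0 = 0 := by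
    rw [← norm_eq_zero, ← sq_eq_zero_iff, mvnLp, sq_norm_toLp_eq_integral,
      mvnIncrement.integral_sq hα]
    simp [Real.zero_rpow (by linarith : 2 * α + 1 ≠ 0)]
  have h1 := sq_norm_mvnLp_sub hα hα2 0 s
  have h2 := sq_norm_mvnLp_sub hα hα2 0 t
  have h3 := sq_norm_mvnLp_sub hα hα2 s t
  rw [h0, sub_zero, sub_zero] at h1 h2
  rw [norm_sub_rev, norm_sub_sq_real] at h3
  linarith

/-- The increments of the Mandelbrot–Van Ness kernel over `[p, q]` are only weakly correlated with
the span of the kernels up to time `k < p`. -/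
lemma abs_inner_mvnLp_sub_le {k p q : ℝ} (hk : 0 ≤ k) (hkp : k < p) (hpq : p ≤ q)
    {f : Lp ℝ 2 (volume : Measure ℝ)} (hf : f ∈ Submodule.span ℝ (mvnLp hα hα2 '' Iic k)) :
    |⟪mvnLp hα hα2 q - mvnLp hα hα2 p, f⟫_ℝ|
      ≤ √(α ^ 2 / (1 - 2 * α)) * (q - p) * (p - k) ^ (α - 1 / 2) * ‖f‖ := by
  have hg : MemLp ((Ioi (-k)).indicator (mvnIncrement α p q)) 2 volume :=
    (mvnIncrement.memLp hα hα2 p q).indicator measurableSet_Ioi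
  -- Kernels of times $t\le k$ vanish for $u\le -k$; this needs $k\ge0$, because of the baseline
  -- term $u_+^\alpha$. Only the part of the increment on $u>-k$ is therefore seen by $f$.
  have horth : ⟪mvnLp hα hα2 q - mvnLp hα hα2 p - hg.toLp _, f⟫_ℝ = 0 := by
    have : Submodule.span ℝ (mvnLp hα hα2 '' Iic k)
        ≤ (ℝ ∙ (mvnLp hα hα2 q - mvnLp hα hα2 p - hg.toLp _))ᗮ := by
      rw [Submodule.span_le]
      rintro _ ⟨t, ht, rfl⟩
      rw [SetLike.mem_coe, Submodule.mem_orthogonal_singleton_iff_inner_right, mvnLp_sub,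
        ← MemLp.toLp_sub, mvnLp, inner_toLp_eq_integral]
      refine integral_eq_zero_of_ae (ae_of_all _ fun u => ?_)
      by_cases hu : -k < u
      · simp [hu]
      · rw [mem_Iic] at ht
        have : mvnIncrement α 0 t u = 0 := by
          unfold mvnIncrement
          rw [max_eq_right (by linarith), max_eq_right (by linarith), sub_self]
        simp [this]
    exact (Submodule.mem_orthogonal_singleton_iff_inner_right).1 (this hf)
  rw [inner_sub_left, sub_eq_zero] at horth
  rw [horth]
  refine (abs_real_inner_le_norm _ _).trans (mul_le_mul_of_nonneg_right ?_ (norm_nonneg _))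
  have h0 : 0 < p - k := by linarith
  refine le_of_sq_le_sq ?_ (by positivity [sub_nonneg.2 hpq])
  rw [sq_norm_toLp_eq_integral]
  have h2 : ∀ u, (Ioi (-k)).indicator (mvnIncrement α p q) u ^ 2
      = (Ioi (-k)).indicator (fun u => mvnIncrement α p q u ^ 2) u := by
    intro u; by_cases hu : u ∈ Ioi (-k) <;> simp [hu]
  simp_rw [h2]
  rw [integral_indicator measurableSet_Ioi]
  refine (mvnIncrement.setIntegral_sq_le hα hα2 hpq hkp).trans (le_of_eq ?_)
  rw [mul_pow, mul_pow, Real.sq_sqrt (div_nonneg (sq_nonneg _) (by linarith)),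
    ← Real.rpow_natCast ((p - k) ^ (α - 1 / 2)), ← Real.rpow_mul h0.le]
  congr 2
  push_cast; ring

end mvnLp

/-! ### Correlation of fractional increments with the past -/

/-- The covariance function of the fractional Brownian motion, for vectors of a Hilbert space. -/
def HasFBMCovariance {E : Type*} [NormedAddCommGroup E] [InnerProductSpace ℝ E] (H : ℝ)
    (b : ℝ → E) : Prop :=
  ∀ s t, ⟪b s, b t⟫_ℝ = (|s| ^ (2 * H) + |t| ^ (2 * H) - |t - s| ^ (2 * H)) / 2

namespace HasFBMCovariance

variable {E : Type*} [NormedAddCommGroup E] [InnerProductSpace ℝ E] {H : ℝ} {b : ℝ → E}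

lemma norm_sub (hb : HasFBMCovariance H b) (hH : 0 < H) (s t : ℝ) :
    ‖b t - b s‖ = |t - s| ^ H := by
  have h : ‖b t - b s‖ ^ 2 = (|t - s| ^ H) ^ 2 := by
    rw [← Real.rpow_natCast (|t - s| ^ H), ← Real.rpow_mul (abs_nonneg _), norm_sub_sq_real,
      ← real_inner_self_eq_norm_sq, ← real_inner_self_eq_norm_sq, hb, hb, hb, abs_sub_comm s t]
    simp only [sub_self, abs_zero, Real.zero_rpow (by linarith : 2 * H ≠ 0)]
    push_cast
    rw [mul_comm H 2]
    ring
  exact (sq_eq_sq₀ (norm_nonneg _) (Real.rpow_nonneg (abs_nonneg _) _)).1 h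

/-- The increments over `[p, q]` are only weakly correlated with the past up to time `k < p`. -/
lemma exists_abs_inner_sub_le (hb : HasFBMCovariance H b) (hH : 1 / 2 < H) (hH1 : H < 1) :
    ∃ C : ℝ, 0 ≤ C ∧ ∀ k p q : ℝ, 0 ≤ k → k < p → p ≤ q →
      ∀ x ∈ Submodule.span ℝ (b '' Iic k),
        |⟪b q - b p, x⟫_ℝ| ≤ C * (q - p) * (p - k) ^ (H - 1) * ‖x‖ := by
  obtain ⟨α, rfl⟩ : ∃ α, H = α + 1 / 2 := ⟨H - 1 / 2, by ring⟩
  have hα : 0 < α := by linarith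
  have hα2 : α < 1 / 2 := by linarith
  have hM := mvnIncrement.mass_pos hα hα2
  set M := mvnIncrement.mass α
  have hΦ : ∀ s t, ⟪mvnLp hα hα2 s, mvnLp hα hα2 t⟫_ℝ = M * ⟪b s, b t⟫_ℝ := by
    intro s t
    rw [inner_mvnLp, hb, show 2 * (α + 1 / 2) = 2 * α + 1 by ring]
  -- $M^{-1}$ undoes the scaling of the inner product, $\sqrt M$ that of the norm of the past
  -- vector.
  refine ⟨M⁻¹ * √(α ^ 2 / (1 - 2 * α)) * √M, by positivity, fun k p q hk hkp hpq x hx => ?_⟩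
  obtain ⟨l, hl, rfl⟩ := (Finsupp.mem_span_image_iff_linearCombination ℝ).1 hx
  have hf : Finsupp.linearCombination ℝ (mvnLp hα hα2) l
      ∈ Submodule.span ℝ (mvnLp hα hα2 '' Iic k) :=
    (Finsupp.mem_span_image_iff_linearCombination ℝ).2 ⟨l, hl, rfl⟩
  have h1 := abs_inner_mvnLp_sub_le hα hα2 hk hkp hpq hf
  have h2 : ⟪mvnLp hα hα2 q - mvnLp hα hα2 p, Finsupp.linearCombination ℝ (mvnLp hα hα2) l⟫_ℝ
      = M * ⟪b q - b p, Finsupp.linearCombination ℝ b l⟫_ℝ := by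
    have := inner_linearCombination_eq_mul hΦ (Finsupp.single q 1 - Finsupp.single p 1) l
    simpa [map_sub] using this
  have h3 : ‖Finsupp.linearCombination ℝ (mvnLp hα hα2) l‖
      = √M * ‖Finsupp.linearCombination ℝ b l‖ := by
    refine (sq_eq_sq₀ (norm_nonneg _) (by positivity)).1 ?_
    rw [mul_pow, Real.sq_sqrt hM.le, ← real_inner_self_eq_norm_sq, ← real_inner_self_eq_norm_sq]
    exact inner_linearCombination_eq_mul hΦ l l
  rw [h2, abs_mul, abs_of_pos hM, h3] at h1
  rw [show α + 1 / 2 - 1 = α - 1 / 2 by ring]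
  calc _ = M⁻¹ * (M * |⟪b q - b p, Finsupp.linearCombination ℝ b l⟫_ℝ|) := by
        field_simp
    _ ≤ M⁻¹ * _ := mul_le_mul_of_nonneg_left h1 (by positivity)
    _ = _ := by ring

end HasFBMCovariance

/-! ### Riemann sums and the Ornstein–Uhlenbeck recursion -/

/-- Abel summation bound for sums with monotone weights in `[0, 1]`. -/
lemma norm_sum_smul_sub_le {E : Type*} [NormedAddCommGroup E] [NormedSpace ℝ E] {w : ℕ → ℝ}
    (hw : Monotone w) (hw0 : ∀ i, 0 ≤ w i) {x : ℕ → E} (hx0 : x 0 = 0) {R : ℝ} {n : ℕ}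
    (hx : ∀ i ≤ n, ‖x i‖ ≤ R) (hwn : w n ≤ 1) :
    ‖∑ i ∈ Finset.range n, w i • (x (i + 1) - x i)‖ ≤ 2 * R := by
  -- Summation by parts: subtracting the boundary term leaves $-\sum(w_{i+1}-w_i)x_{i+1}$, and the
  -- weight increments are nonnegative and telescope.
  have key : ∀ j ≤ n, ‖(∑ i ∈ Finset.range j, w i • (x (i + 1) - x i)) - w j • x j‖
      ≤ (w j - w 0) * R := by
    intro j
    induction j with
    | zero => simp [hx0]
    | succ j ih =>
      intro hj
      have h1 : (∑ i ∈ Finset.range (j + 1), w i • (x (i + 1) - x i)) - w (j + 1) • x (j + 1)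
          = ((∑ i ∈ Finset.range j, w i • (x (i + 1) - x i)) - w j • x j)
            - (w (j + 1) - w j) • x (j + 1) := by
        rw [Finset.sum_range_succ]; module
      rw [h1]
      refine (norm_sub_le _ _).trans ?_
      have h2 := ih (by omega)
      have h3 : 0 ≤ w (j + 1) - w j := sub_nonneg.2 (hw (Nat.le_succ j))
      rw [norm_smul, Real.norm_of_nonneg h3]
      have h4 := mul_le_mul_of_nonneg_left (hx (j + 1) hj) h3
      linarith
  have hR : 0 ≤ R := (norm_nonneg _).trans (hx 0 (Nat.zero_le _))
  have h1 := key n le_rfl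
  have h2 : ‖w n • x n‖ ≤ R := by
    rw [norm_smul, Real.norm_of_nonneg (hw0 n)]
    exact (mul_le_of_le_one_left (norm_nonneg _) hwn).trans (hx n le_rfl)
  have h3 := norm_add_le ((∑ i ∈ Finset.range n, w i • (x (i + 1) - x i)) - w n • x n) (w n • x n)
  rw [sub_add_cancel] at h3
  have h4 : (w n - w 0) * R ≤ R := mul_le_of_le_one_left hR (by linarith [hw0 0])
  linarith

/-- The left Riemann–Stieltjes sum of `f` against `b` with `n` steps of size `h` from `a`. -/
noncomputable def riemannSum {E : Type*} [AddCommGroup E] [Module ℝ E] (f : ℝ → ℝ) (b : ℝ → E)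
    (a h : ℝ) (n : ℕ) : E :=
  ∑ i ∈ Finset.range n, f (a + i * h) • (b (a + (i + 1 : ℕ) * h) - b (a + i * h))

lemma riemannSum_add {E : Type*} [AddCommGroup E] [Module ℝ E] (f : ℝ → ℝ) (b : ℝ → E)
    (a h : ℝ) (m n : ℕ) :
    riemannSum f b a h (m + n) = riemannSum f b a h m + riemannSum f b (a + m * h) h n := by
  unfold riemannSum
  rw [Finset.sum_range_add]
  congr 1
  refine Finset.sum_congr rfl fun i _ => ?_
  congr 2 <;> push_cast <;> ring_nf

lemma riemannSum_const_mul {E : Type*} [AddCommGroup E] [Module ℝ E] (c : ℝ) (f : ℝ → ℝ)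
    (b : ℝ → E) (a h : ℝ) (n : ℕ) :
    riemannSum (fun x => c * f x) b a h n = c • riemannSum f b a h n := by
  simp [riemannSum, Finset.smul_sum, mul_smul]

/-- `Y` is a normalised Ornstein–Uhlenbeck process driven by `b`, for vectors of a Hilbert
space. -/
structure IsOUVector {E : Type*} [NormedAddCommGroup E] [InnerProductSpace ℝ E] (b : ℝ → E)
    (σ : ℝ) (Y : ℝ → E) : Prop where
  norm_eq : ∀ t, ‖Y t‖ = 1
  tendsto_sum : ∀ s t, s < t → Tendsto (fun n : ℕ =>
    σ • riemannSum (fun u => Real.exp (-(t - u))) b s ((t - s) / n) n) atTop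
    (𝓝 (Y t - Real.exp (-(t - s)) • Y s))

/-- A left sum for $\int_s^te^{-(t-u)}\,du\le1$ with an increasing integrand; the comparison is
termwise from $h\le e^h-1$ and telescopes. -/
lemma sum_exp_mul_le {s t h : ℝ} {n : ℕ} (hh : s + n * h = t) :
    ∑ i ∈ Finset.range n, Real.exp (-(t - (s + i * h))) * h ≤ 1 := by
  have key : ∀ i ∈ Finset.range n, Real.exp (-(t - (s + i * h))) * h
      ≤ Real.exp (-(t - (s + (i + 1 : ℕ) * h))) - Real.exp (-(t - (s + i * h))) := by
    intro i _
    have : -(t - (s + (i + 1 : ℕ) * h)) = -(t - (s + i * h)) + h := by push_cast; ring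
    rw [this, Real.exp_add]
    have h1 := mul_le_mul_of_nonneg_left (Real.add_one_le_exp h)
      (Real.exp_pos (-(t - (s + i * h)))).le
    linarith
  refine (Finset.sum_le_sum key).trans ?_
  rw [Finset.sum_range_sub (fun i : ℕ => Real.exp (-(t - (s + i * h))))]
  rw [hh, sub_self, neg_zero, Real.exp_zero]
  linarith [Real.exp_pos (-(t - (s + (0 : ℕ) * h)))]

namespace IsOUVector

variable {E : Type*} [NormedAddCommGroup E] [InnerProductSpace ℝ E] {H σ : ℝ} {b Y : ℝ → E}

lemma riemannSum_mem (f : ℝ → ℝ) (b : ℝ → E) (a h : ℝ) (n : ℕ) :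
    riemannSum f b a h n ∈ Submodule.span ℝ (range b) :=
  Submodule.sum_mem _ fun _ _ => Submodule.smul_mem _ _ (Submodule.sub_mem _
    (Submodule.subset_span (mem_range_self _)) (Submodule.subset_span (mem_range_self _)))

/-- The Riemann sums place $Y_t-e^{-(t-s)}Y_s$ in the closed span; letting $s\to-\infty$ removes the
second term, since $\|Y_s\|=1$. -/
lemma mem_closure (hY : IsOUVector b σ Y) (t : ℝ) :
    Y t ∈ (Submodule.span ℝ (range b)).topologicalClosure := by
  have h1 : ∀ s < t, Y t - Real.exp (-(t - s)) • Y s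
      ∈ (Submodule.span ℝ (range b)).topologicalClosure := fun s hs =>
    mem_closure_of_tendsto (hY.tendsto_sum s t hs) (Eventually.of_forall fun n =>
      Submodule.smul_mem _ _ (riemannSum_mem _ _ _ _ _))
  have h2 : Tendsto (fun s => Y t - Real.exp (-(t - s)) • Y s) atBot (𝓝 (Y t - 0)) := by
    refine tendsto_const_nhds.sub (squeeze_zero_norm (a := fun s => Real.exp (s - t)) ?_ ?_)
    · intro s
      rw [norm_smul, hY.norm_eq, mul_one, Real.norm_of_nonneg (Real.exp_pos _).le]
      exact le_of_eq (by ring_nf)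
    · exact Real.tendsto_exp_atBot.comp (tendsto_atBot_add_const_right _ (-t) tendsto_id)
  rw [sub_zero] at h2
  exact (Submodule.isClosed_topologicalClosure _).mem_of_tendsto h2
    ((eventually_lt_atBot t).mono h1)

/-- Abel summation replaces a variance computation: the weights are monotone in $[0,1]$ and
$\|b_u-b_s\|\le(t-s)^H$ on $[s,t]$. The bound gives continuity of $Y$, needed for measurability in
time. -/
lemma norm_sub_exp_smul_le (hb : HasFBMCovariance H b) (hH : 0 < H) (hY : IsOUVector b σ Y)
    {s t : ℝ} (hst : s < t) :
    ‖Y t - Real.exp (-(t - s)) • Y s‖ ≤ |σ| * (2 * (t - s) ^ H) := by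
  refine le_of_tendsto (hY.tendsto_sum s t hst).norm ?_
  filter_upwards [eventually_gt_atTop 0] with n hn
  rw [norm_smul, Real.norm_eq_abs]
  refine mul_le_mul_of_nonneg_left ?_ (abs_nonneg σ)
  have hn' : (0 : ℝ) < n := by exact_mod_cast hn
  set h := (t - s) / n with hh
  have hh0 : 0 ≤ h := div_nonneg (by linarith) hn'.le
  have hnh : n * h = t - s := by rw [hh]; field_simp
  have := norm_sum_smul_sub_le (w := fun i : ℕ => Real.exp (-(t - (s + i * h))))
    (x := fun i : ℕ => b (s + i * h) - b s) (n := n) (R := (t - s) ^ H) ?_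
    (fun i => (Real.exp_pos _).le) (by simp) ?_ ?_
  · simpa only [riemannSum, sub_sub_sub_cancel_right] using this
  · intro i j hij
    have : (i : ℝ) * h ≤ j * h := mul_le_mul_of_nonneg_right (by exact_mod_cast hij) hh0
    exact Real.exp_le_exp.2 (by linarith)
  · intro i hi
    have h1 : (i : ℝ) * h ≤ n * h := mul_le_mul_of_nonneg_right (by exact_mod_cast hi) hh0
    have h2 : 0 ≤ (i : ℝ) * h := by positivity
    rw [hb.norm_sub hH, add_sub_cancel_left, abs_of_nonneg h2]
    exact Real.rpow_le_rpow h2 (by linarith) hH.le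
  · rw [hnh]; simp

lemma continuous (hb : HasFBMCovariance H b) (hH : 0 < H) (hY : IsOUVector b σ Y) :
    Continuous Y := by
  have key : ∀ s t, s < t → ‖Y t - Y s‖ ≤ |σ| * (2 * |t - s| ^ H) + |1 - Real.exp (-|t - s|)| := by
    intro s t hst
    have h1 := norm_sub_exp_smul_le hb hH hY hst
    have h2 : Y t - Y s = (Y t - Real.exp (-(t - s)) • Y s)
        - (1 - Real.exp (-(t - s))) • Y s := by module
    rw [h2, abs_of_pos (sub_pos.2 hst)]
    refine (norm_sub_le _ _).trans (add_le_add h1 ?_)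
    rw [norm_smul, hY.norm_eq, mul_one, Real.norm_eq_abs]
  have key2 : ∀ s t, ‖Y t - Y s‖ ≤ |σ| * (2 * |t - s| ^ H) + |1 - Real.exp (-|t - s|)| := by
    intro s t
    rcases lt_trichotomy s t with h | rfl | h
    · exact key s t h
    · simp only [sub_self, norm_zero]; positivity
    · rw [norm_sub_rev, abs_sub_comm t s]; exact key t s h
  rw [continuous_iff_continuousAt]
  intro s
  rw [ContinuousAt, tendsto_iff_norm_sub_tendsto_zero]
  refine squeeze_zero (fun _ => norm_nonneg _) (key2 s) ?_
  have hc : Continuous fun t => |σ| * (2 * |t - s| ^ H) + |1 - Real.exp (-|t - s|)| := by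
    refine Continuous.add ?_ (by fun_prop)
    exact continuous_const.mul (continuous_const.mul
      (Continuous.rpow_const (by fun_prop) fun _ => Or.inr hH.le))
  simpa [Real.zero_rpow hH.ne'] using hc.tendsto s

/-- Increments of length $h$ after time $s$ contribute at most $Ch(s-k)^{H-1}\|x\|$, as the exponent
is negative. The exponential weights times $h$ sum to at most $1$, so no factor $t-s$ appears. -/
lemma abs_inner_sub_exp_smul_le (hY : IsOUVector b σ Y) {C : ℝ} (hC : 0 ≤ C) (hH1 : H < 1)
    {k : ℝ} {x : E}
    (hx : ∀ p q : ℝ, k < p → p ≤ q → |⟪b q - b p, x⟫_ℝ| ≤ C * (q - p) * (p - k) ^ (H - 1) * ‖x‖)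
    {s t : ℝ} (hks : k < s) (hst : s < t) :
    |⟪Y t - Real.exp (-(t - s)) • Y s, x⟫_ℝ| ≤ |σ| * (C * (s - k) ^ (H - 1) * ‖x‖) := by
  refine le_of_tendsto ((hY.tendsto_sum s t hst).inner tendsto_const_nhds).abs ?_
  filter_upwards [eventually_gt_atTop 0] with n hn
  rw [real_inner_smul_left, abs_mul]
  refine mul_le_mul_of_nonneg_left ?_ (abs_nonneg σ)
  have hn' : (0 : ℝ) < n := by exact_mod_cast hn
  set h := (t - s) / n with hh
  have hh0 : 0 ≤ h := div_nonneg (by linarith) hn'.le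
  have hnh : n * h = t - s := by rw [hh]; field_simp
  have hK : 0 ≤ C * (s - k) ^ (H - 1) * ‖x‖ :=
    mul_nonneg (mul_nonneg hC (Real.rpow_nonneg (by linarith) _)) (norm_nonneg _)
  rw [riemannSum, sum_inner]
  calc _ ≤ ∑ i ∈ Finset.range n, |⟪Real.exp (-(t - (s + i * h))) •
          (b (s + (i + 1 : ℕ) * h) - b (s + i * h)), x⟫_ℝ| := Finset.abs_sum_le_sum_abs _ _
    _ ≤ ∑ i ∈ Finset.range n, (Real.exp (-(t - (s + i * h))) * h)
          * (C * (s - k) ^ (H - 1) * ‖x‖) := by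
        refine Finset.sum_le_sum fun i _ => ?_
        have hi : 0 ≤ (i : ℝ) * h := by positivity
        rw [real_inner_smul_left, abs_mul, abs_of_pos (Real.exp_pos _), mul_assoc]
        refine mul_le_mul_of_nonneg_left ?_ (Real.exp_pos _).le
        refine (hx (s + i * h) (s + (i + 1 : ℕ) * h) (by linarith)
          (by push_cast; linarith)).trans ?_
        have h1 : s + (i + 1 : ℕ) * h - (s + i * h) = h := by push_cast; ring
        have h2 : (s + i * h - k) ^ (H - 1) ≤ (s - k) ^ (H - 1) :=
          Real.rpow_le_rpow_of_nonpos (by linarith) (by linarith) (by linarith)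
        rw [h1]
        calc _ ≤ C * h * (s - k) ^ (H - 1) * ‖x‖ := by gcongr
          _ = _ := by ring
    _ ≤ _ := by
        rw [← Finset.sum_mul]
        exact mul_le_of_le_one_left hK (sum_exp_mul_le (by linarith))

/-- The correlation of the Ornstein–Uhlenbeck process at time `t` with the past up to time `k`
is of order `(t - k) ^ (H - 1)`. -/
lemma exists_abs_inner_le (hb : HasFBMCovariance H b) (hH : 1 / 2 < H) (hH1 : H < 1)
    (hY : IsOUVector b σ Y) :
    ∃ C : ℝ, 0 ≤ C ∧ ∀ k t : ℝ, 0 ≤ k → k + 1 ≤ t →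
      ∀ x ∈ (Submodule.span ℝ (b '' Iic k)).topologicalClosure,
        |⟪Y t, x⟫_ℝ| ≤ C * (t - k) ^ (H - 1) * ‖x‖ := by
  obtain ⟨C, hC, hCb⟩ := hb.exists_abs_inner_sub_le hH hH1
  refine ⟨2 + |σ| * C * (1 / 2) ^ (H - 1), by positivity, fun k t hk hkt x hx => ?_⟩
  -- The estimate is a closed condition on $x$, so it is enough to prove it on the linear span.
  have hcl : IsClosed {x | |⟪Y t, x⟫_ℝ|
      ≤ (2 + |σ| * C * (1 / 2) ^ (H - 1)) * (t - k) ^ (H - 1) * ‖x‖} :=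
    isClosed_le (by fun_prop) (by fun_prop)
  refine (closure_minimal (fun x hx => ?_) hcl) hx
  simp only [mem_ofPred_eq]
  -- With $s$ the midpoint, $s-k$ is comparable to $t-k$, while the memory term $e^{-(t-s)}Y_s$ is
  -- exponentially small in $t-k$.
  set s := (k + t) / 2 with hs
  have hsk : s - k = 1 / 2 * (t - k) := by rw [hs]; ring
  have h1 := abs_inner_sub_exp_smul_le (s := s) (t := t) hY hC hH1
    (fun p q hp hq => hCb k p q hk hp hq x hx) (by linarith) (by linarith)
  rw [hsk, Real.mul_rpow (by norm_num) (by linarith)] at h1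
  rw [inner_sub_left, real_inner_smul_left] at h1
  have h2 : Real.exp (-(t - s)) ≤ 2 * (t - k) ^ (H - 1) := by
    -- Use $e^{-x}\le1/x$; then $t-k\ge1$ permits raising the exponent from $-1$ to $H-1$.
    have h3 : Real.exp (-(t - s)) ≤ 2 * (t - k)⁻¹ := by
      have h4 := Real.add_one_le_exp (t - s)
      rw [Real.exp_neg, show 2 * (t - k)⁻¹ = ((t - k) / 2)⁻¹ by rw [inv_div]; ring]
      exact inv_anti₀ (by linarith) (by linarith)
    refine h3.trans (mul_le_mul_of_nonneg_left ?_ zero_le_two)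
    rw [← Real.rpow_neg_one]
    exact Real.rpow_le_rpow_of_exponent_le (by linarith) (by linarith)
  have h3 : |⟪Y s, x⟫_ℝ| ≤ ‖x‖ := by simpa [hY.norm_eq] using abs_real_inner_le_norm (Y s) x
  have h4 : |Real.exp (-(t - s)) * ⟪Y s, x⟫_ℝ| ≤ 2 * (t - k) ^ (H - 1) * ‖x‖ := by
    rw [abs_mul, abs_of_pos (Real.exp_pos _)]
    exact mul_le_mul h2 h3 (abs_nonneg _)
      (mul_nonneg zero_le_two (Real.rpow_nonneg (by linarith) _))
  have h5 := abs_add_le (⟪Y t, x⟫_ℝ - Real.exp (-(t - s)) * ⟪Y s, x⟫_ℝ)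
    (Real.exp (-(t - s)) * ⟪Y s, x⟫_ℝ)
  rw [sub_add_cancel] at h5
  calc _ ≤ _ := h5
    _ ≤ _ := add_le_add h1 h4
    _ = _ := by ring

end IsOUVector

/-! ### From processes to vectors of $L^2(P)$ -/

section Bridge

variable {Ω : Type*} [MeasurableSpace Ω] {P : Measure Ω}

lemma IsFractionalBM.memLp {H : ℝ} {B : ℝ → Ω → ℝ} (hB : IsFractionalBM P H B) (t : ℝ) :
    MemLp (B t) 2 P :=
  (hB.gaussian.hasGaussianLaw_eval t).memLp_two

/-- The values of a fractional Brownian motion as vectors of `L²(P)`. -/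
noncomputable def IsFractionalBM.vec {H : ℝ} {B : ℝ → Ω → ℝ} (hB : IsFractionalBM P H B) (t : ℝ) :
    Lp ℝ 2 P :=
  (hB.memLp t).toLp _

lemma IsFractionalBM.hasFBMCovariance {H : ℝ} {B : ℝ → Ω → ℝ} (hB : IsFractionalBM P H B) :
    HasFBMCovariance H hB.vec := by
  intro s t
  rw [IsFractionalBM.vec, IsFractionalBM.vec, inner_toLp_eq_integral, hB.covariance]

lemma IsStationaryFOU.memLp {B y : ℝ → Ω → ℝ} {σ : ℝ} (hy : IsStationaryFOU P B σ y) (t : ℝ) :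
    MemLp (y t) 2 P :=
  (hy.law t).hasGaussianLaw.memLp_two

/-- The values of a fractional Ornstein–Uhlenbeck process as vectors of `L²(P)`. -/
noncomputable def IsStationaryFOU.vec {B y : ℝ → Ω → ℝ} {σ : ℝ} (hy : IsStationaryFOU P B σ y)
    (t : ℝ) : Lp ℝ 2 P :=
  (hy.memLp t).toLp _

lemma integral_sq_gaussianReal (v : NNReal) : ∫ x, x ^ 2 ∂(gaussianReal 0 v) = v := by
  have h := variance_id_gaussianReal (μ := 0) (v := v)
  rwa [variance_of_integral_eq_zero aemeasurable_id (by simp)] at h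

lemma IsStationaryFOU.norm_vec {B y : ℝ → Ω → ℝ} {σ : ℝ} (hy : IsStationaryFOU P B σ y) (t : ℝ) :
    ‖hy.vec t‖ = 1 := by
  rw [← sq_eq_sq₀ (norm_nonneg _) zero_le_one, IsStationaryFOU.vec, sq_norm_toLp_eq_integral]
  have := (hy.law t).integral_comp (f := fun x => x ^ 2) (by fun_prop)
  simp only [Function.comp_def] at this
  rw [this, integral_sq_gaussianReal]
  simp

lemma eLpNorm_sub_toReal_eq_norm {f g : Lp ℝ 2 P} {u : Ω → ℝ} (h : ⇑(f - g) =ᵐ[P] u) :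
    ‖f - g‖ = (eLpNorm u 2 P).toReal := by
  rw [Lp.norm_def, eLpNorm_congr_ae h]

lemma HasMeanSquareIntegral.exists_norm_riemannSum_sub_lt {H : ℝ} {B : ℝ → Ω → ℝ}
    (hB : IsFractionalBM P H B) {f : ℝ → ℝ} {a c : ℝ} {J : Ω → ℝ}
    (hJ : HasMeanSquareIntegral P f B a c J) {ε : ℝ} (hε : 0 < ε) :
    ∃ δ : ℝ, 0 < δ ∧ ∀ (n : ℕ) (h : ℝ), 0 ≤ h → h < δ → a + n * h = c →
      ‖riemannSum f hB.vec a h n - hJ.1.toLp J‖ < ε := by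
  obtain ⟨δ, hδ, key⟩ := hJ.2 ε hε
  refine ⟨δ, hδ, fun n h h0 hhδ hn => ?_⟩
  have h1 := key n (fun i => a + i * h) (fun i => a + i * h) (by simp) hn
    (fun i _ => ⟨le_rfl, by push_cast; linarith, by push_cast; linarith⟩)
  have hmem : ∀ i : ℕ, MemLp (fun ω => f (a + i * h) *
      (B (a + (i + 1 : ℕ) * h) ω - B (a + i * h) ω)) 2 P := fun i =>
    ((hB.memLp _).sub (hB.memLp _)).const_mul _
  have hsum : ∀ m : ℕ, ⇑(riemannSum f hB.vec a h m) =ᵐ[P] fun ω => ∑ i ∈ Finset.range m,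
      f (a + i * h) * (B (a + (i + 1 : ℕ) * h) ω - B (a + i * h) ω) := by
    intro m
    induction m with
    | zero =>
      filter_upwards [Lp.coeFn_zero ℝ 2 P] with ω hω
      simpa [riemannSum] using hω
    | succ m ih =>
      have e : riemannSum f hB.vec a h (m + 1)
          = riemannSum f hB.vec a h m + (hmem m).toLp _ := by
        rw [riemannSum, Finset.sum_range_succ]
        rfl
      rw [e]
      filter_upwards [ih, (hmem m).coeFn_toLp,
        Lp.coeFn_add (riemannSum f hB.vec a h m) ((hmem m).toLp _)] with ω h1 h2 h3
      rw [h3, Pi.add_apply, h1, h2, Finset.sum_range_succ]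
  rw [eLpNorm_sub_toReal_eq_norm (u := fun ω => (∑ i ∈ Finset.range n,
      f (a + i * h) * (B (a + (i + 1 : ℕ) * h) ω - B (a + i * h) ω)) - J ω)]
  · exact (ENNReal.lt_ofReal_iff_toReal_lt h1.ne_top).1 h1
  · filter_upwards [hsum n, hJ.1.coeFn_toLp, Lp.coeFn_sub (riemannSum f hB.vec a h n)
      (hJ.1.toLp J)] with ω h1 h2 h3
    rw [h3, Pi.sub_apply, h1, h2]

lemma HasMeanSquareIntegralIic.eventually_exists {f : ℝ → ℝ} {B : ℝ → Ω → ℝ} {c : ℝ} {J : Ω → ℝ}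
    (hJ : HasMeanSquareIntegralIic P f B c J) {ε : ℝ} (hε : 0 < ε) :
    ∀ᶠ a in atBot, ∃ (I : Ω → ℝ) (hI : HasMeanSquareIntegral P f B a c I),
      ‖hI.1.toLp I - hJ.1.toLp J‖ < ε := by
  obtain ⟨hm, I, hI, hlim⟩ := hJ
  filter_upwards [eventually_lt_atBot c,
    hlim.eventually_lt_const (ENNReal.ofReal_pos.2 hε)] with a hac ha
  refine ⟨I a, hI a hac, ?_⟩
  rw [← MemLp.toLp_sub, Lp.norm_toLp]
  exact (ENNReal.lt_ofReal_iff_toReal_lt ha.ne_top).1 ha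

/-- Splitting at $s$ the Riemann sums from a remote starting point $a$ to $t$ gives
$\int_a^t=e^{-(t-s)}\int_a^s+\int_s^t$, up to errors from the mesh and from the truncation at $a$.
-/
lemma IsStationaryFOU.isOUVector {H : ℝ} {B y : ℝ → Ω → ℝ} {σ : ℝ} (hB : IsFractionalBM P H B)
    (hy : IsStationaryFOU P B σ y) : IsOUVector hB.vec σ hy.vec := by
  refine ⟨hy.norm_vec, fun s t hst => ?_⟩
  obtain ⟨Jt, hJt, hyt⟩ := hy.integral_eq t
  obtain ⟨Js, hJs, hys⟩ := hy.integral_eq s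
  have e : ∀ {r : ℝ} {J : Ω → ℝ} (hJ : MemLp J 2 P), (y r =ᵐ[P] fun ω => σ * J ω) →
      hy.vec r = σ • hJ.toLp J := by
    intro r J hJ h
    rw [← MemLp.toLp_const_smul]
    exact (MemLp.toLp_eq_toLp_iff _ _).2 h
  rw [e hJt.1 hyt, e hJs.1 hys, smul_comm, ← smul_sub]
  refine Tendsto.const_smul ?_ σ
  rw [Metric.tendsto_atTop]
  intro ε hε
  have hd : 0 < t - s := by linarith
  -- The starting points differ from $t$ by multiples of $t-s$, so that a grid of step $(t-s)/n$ has
  -- both $s$ and $t$ among its nodes.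
  have hlim : Tendsto (fun N : ℕ => t - ((N : ℝ) + 2) * (t - s)) atTop atBot := by
    refine tendsto_const_nhds.add_atBot (tendsto_neg_atTop_atBot.comp ?_)
    exact (tendsto_atTop_add_const_right _ _ tendsto_natCast_atTop_atTop).atTop_mul_const hd
  obtain ⟨N, ⟨It, hIt, hIt'⟩, ⟨Is, hIs, hIs'⟩⟩ := (hlim.eventually
    ((hJt.eventually_exists (by positivity : 0 < ε / 4)).and
      (hJs.eventually_exists (by positivity : 0 < ε / 4)))).exists
  set a := t - ((N : ℝ) + 2) * (t - s) with ha
  obtain ⟨δ₁, hδ₁, h₁⟩ := hIt.exists_norm_riemannSum_sub_lt hB (by positivity : 0 < ε / 4)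
  obtain ⟨δ₂, hδ₂, h₂⟩ := hIs.exists_norm_riemannSum_sub_lt hB (by positivity : 0 < ε / 4)
  have hev : ∀ᶠ n : ℕ in atTop, (t - s) / n < min δ₁ δ₂ :=
    (tendsto_const_div_atTop_nhds_zero_nat (t - s)).eventually_lt_const (lt_min hδ₁ hδ₂)
  obtain ⟨n₀, hn₀⟩ := eventually_atTop.1 (hev.and (eventually_gt_atTop 0))
  refine ⟨n₀, fun n hn => ?_⟩
  obtain ⟨hlt, hn⟩ := hn₀ n hn
  have hn' : (0 : ℝ) < n := by exact_mod_cast hn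
  set h := (t - s) / n with hh
  have hh0 : 0 ≤ h := div_nonneg hd.le hn'.le
  have hnh : n * h = t - s := by rw [hh]; field_simp
  have hs : a + ((N + 1) * n : ℕ) * h = s := by
    push_cast; rw [mul_assoc, hnh, ha]; ring
  have ht : a + ((N + 1) * n + n : ℕ) * h = t := by
    push_cast; rw [add_mul, mul_assoc, hnh, ha]; ring
  have k1 := h₁ _ h hh0 (hlt.trans_le (min_le_left _ _)) ht
  have k2 := h₂ _ h hh0 (hlt.trans_le (min_le_right _ _)) hs
  rw [riemannSum_add, hs] at k1
  have hexp : (fun u => Real.exp (-(t - u)))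
      = fun u => Real.exp (-(t - s)) * Real.exp (-(s - u)) := by
    ext u; rw [← Real.exp_add]; ring_nf
  have k3 : riemannSum (fun u => Real.exp (-(t - u))) hB.vec a h ((N + 1) * n)
      = Real.exp (-(t - s)) • riemannSum (fun u => Real.exp (-(s - u))) hB.vec a h ((N + 1) * n) := by
    rw [hexp, riemannSum_const_mul]
  rw [k3] at k1
  set R := riemannSum (fun u => Real.exp (-(s - u))) hB.vec a h ((N + 1) * n)
  set S := riemannSum (fun u => Real.exp (-(t - u))) hB.vec s h n
  have hle : Real.exp (-(t - s)) ≤ 1 := Real.exp_le_one_iff.2 (by linarith)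
  set ρ := Real.exp (-(t - s))
  have hρ : 0 ≤ ρ := (Real.exp_pos _).le
  have e2 : S - (hJt.1.toLp Jt - ρ • hJs.1.toLp Js)
      = (ρ • R + S - hIt.1.toLp It) + (hIt.1.toLp It - hJt.1.toLp Jt)
        - ρ • ((R - hIs.1.toLp Is) + (hIs.1.toLp Is - hJs.1.toLp Js)) := by module
  rw [dist_eq_norm, e2]
  have k4 : ‖ρ • ((R - hIs.1.toLp Is) + (hIs.1.toLp Is - hJs.1.toLp Js))‖ < ε / 4 + ε / 4 := by
    rw [norm_smul, Real.norm_of_nonneg hρ]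
    refine (mul_le_of_le_one_left (norm_nonneg _) hle).trans_lt ?_
    exact (norm_add_le _ _).trans_lt (add_lt_add k2 hIs')
  calc _ ≤ _ := norm_sub_le _ _
    _ < (ε / 4 + ε / 4) + (ε / 4 + ε / 4) :=
        add_lt_add ((norm_add_le _ _).trans_lt (add_lt_add k1 hIt')) k4
    _ = ε := by ring

end Bridge

/-! ### The Gaussian Hilbert space of $B$ and independence -/

section GaussianHilbert

variable {Ω : Type*} [mΩ : MeasurableSpace Ω] {P : Measure Ω}

lemma Lp_coeFn_finset_sum {ι : Type*} (s : Finset ι) (f : ι → Lp ℝ 2 P) :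
    ⇑(∑ i ∈ s, f i) =ᵐ[P] fun ω => ∑ i ∈ s, f i ω := by
  classical
  induction s using Finset.induction_on with
  | empty =>
    filter_upwards [Lp.coeFn_zero ℝ 2 P] with ω hω
    simpa using hω
  | insert a s ha ih =>
    rw [Finset.sum_insert ha]
    filter_upwards [ih, Lp.coeFn_add (f a) (∑ i ∈ s, f i)] with ω h1 h2
    rw [h2, Pi.add_apply, h1, Finset.sum_insert ha]

lemma Lp_coeFn_sum_smul {ι : Type*} (s : Finset ι) (c : ι → ℝ) (f : ι → Lp ℝ 2 P) :
    ⇑(∑ i ∈ s, c i • f i) =ᵐ[P] fun ω => ∑ i ∈ s, c i * f i ω := by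
  have h : ∀ᵐ ω ∂P, ∀ i ∈ s, (c i • f i : Lp ℝ 2 P) ω = c i * f i ω := by
    refine (eventually_all_finset s).2 fun i _ => ?_
    filter_upwards [Lp.coeFn_smul (c i) (f i)] with ω hω
    rw [hω]; rfl
  filter_upwards [h, Lp_coeFn_finset_sum s (fun i => c i • f i)] with ω h1 h2
  rw [h2]
  exact Finset.sum_congr rfl h1

/-- Characteristic functions are Lipschitz in the $L^2$ variable, which makes Gaussianity a closed
condition. -/
lemma dist_integral_exp_le [IsProbabilityMeasure P] (u : ℝ) (f g : Lp ℝ 2 P) :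
    dist (∫ ω, Complex.exp (u * f ω * Complex.I) ∂P) (∫ ω, Complex.exp (u * g ω * Complex.I) ∂P)
      ≤ |u| * dist f g := by
  have hi : ∀ f : Lp ℝ 2 P, Integrable (fun ω => Complex.exp (u * f ω * Complex.I)) P := by
    intro f
    have hf := Lp.aestronglyMeasurable f
    refine Integrable.of_bound (C := 1)
      (Continuous.comp_aestronglyMeasurable (g := fun x : ℝ => Complex.exp (u * x * Complex.I))
        (by fun_prop) hf) (ae_of_all _ fun ω => ?_)
    rw [← Complex.ofReal_mul, Complex.norm_exp_ofReal_mul_I]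
  have hfg : MemLp (f - g : Lp ℝ 2 P) 2 P := Lp.memLp _
  rw [dist_eq_norm, dist_eq_norm, ← integral_sub (hi f) (hi g)]
  refine (norm_integral_le_integral_norm _).trans ?_
  calc _ ≤ ∫ ω, |u| * ‖(f - g : Lp ℝ 2 P) ω‖ ∂P := by
        refine integral_mono_ae ((hi f).sub (hi g)).norm
          ((hfg.integrable one_le_two).norm.const_mul _) ?_
        filter_upwards [Lp.coeFn_sub f g] with ω hω
        rw [hω]
        have h1 : Complex.exp (u * f ω * Complex.I) - Complex.exp (u * g ω * Complex.I)
            = Complex.exp ((u * g ω : ℝ) * Complex.I)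
              * (Complex.exp (Complex.I * (u * (f ω - g ω) : ℝ)) - 1) := by
          rw [mul_sub, ← Complex.exp_add, mul_one]
          push_cast; ring_nf
        simp only [h1, norm_mul, Complex.norm_exp_ofReal_mul_I, one_mul]
        refine Real.norm_exp_I_mul_ofReal_sub_one_le.trans (le_of_eq ?_)
        rw [norm_mul, Real.norm_eq_abs u]; rfl
    _ ≤ _ := by
        rw [integral_const_mul]
        refine mul_le_mul_of_nonneg_left ?_ (abs_nonneg u)
        rw [integral_norm_eq_lintegral_enorm hfg.1, ← eLpNorm_one_eq_lintegral_enorm, Lp.norm_def]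
        exact ENNReal.toReal_mono hfg.2.ne
          (eLpNorm_le_eLpNorm_of_exponent_le one_le_two hfg.1)

/-- The `L²` limits of centred Gaussian random variables are centred Gaussian. -/
lemma isClosed_map_eq_gaussianReal [IsProbabilityMeasure P] :
    IsClosed {f : Lp ℝ 2 P | P.map f = gaussianReal 0 (‖f‖₊ ^ 2)} := by
  have h : {f : Lp ℝ 2 P | P.map f = gaussianReal 0 (‖f‖₊ ^ 2)}
      = ⋂ u : ℝ, {f : Lp ℝ 2 P | ∫ ω, Complex.exp (u * f ω * Complex.I) ∂P
        = Complex.exp (-((‖f‖ ^ 2 : ℝ) : ℂ) * (u : ℂ) ^ 2 / 2)} := by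
    ext f
    have hf := (Lp.aestronglyMeasurable f).aemeasurable
    have hprob : IsProbabilityMeasure (P.map f) := Measure.isProbabilityMeasure_map hf
    have hc : ∀ u : ℝ, charFun (P.map f) u = ∫ ω, Complex.exp (u * f ω * Complex.I) ∂P := by
      intro u
      rw [charFun_apply_real, integral_map hf (by fun_prop)]
    have hg : ∀ u : ℝ, charFun (gaussianReal 0 (‖f‖₊ ^ 2)) u
        = Complex.exp (-((‖f‖ ^ 2 : ℝ) : ℂ) * (u : ℂ) ^ 2 / 2) := by
      intro u
      rw [charFun_gaussianReal]
      push_cast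
      simp [neg_div]
    simp only [mem_iInter, mem_ofPred_eq]
    constructor
    · intro h u
      rw [← hc, ← hg, h]
    · intro h
      exact Measure.ext_of_charFun (funext fun u => by rw [hc, hg, h u])
  rw [h]
  refine isClosed_iInter fun u => isClosed_eq ?_ ?_
  · exact (LipschitzWith.of_dist_le_mul (K := ⟨|u|, abs_nonneg u⟩)
      (dist_integral_exp_le u)).continuous
  · have : Continuous fun f : Lp ℝ 2 P => ‖f‖ ^ 2 := by fun_prop
    have h2 : Continuous fun f : Lp ℝ 2 P => ((‖f‖ ^ 2 : ℝ) : ℂ) :=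
      Complex.continuous_ofReal.comp this
    fun_prop

lemma map_eq_gaussianReal_of_hasGaussianLaw [IsProbabilityMeasure P] {f : Lp ℝ 2 P}
    (hf : HasGaussianLaw f P) (h0 : ∫ ω, f ω ∂P = 0) :
    P.map f = gaussianReal 0 (‖f‖₊ ^ 2) := by
  rw [hf.map_eq_gaussianReal, h0, variance_of_integral_eq_zero hf.aemeasurable h0]
  congr 1
  have := sq_norm_toLp_eq_integral (Lp.memLp f)
  rw [Lp.toLp_coeFn] at this
  rw [← this]
  ext
  simp

/-- A set of vectors of `L²(P)` all of whose linear combinations are centred Gaussian variables. -/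
def IsGaussianSubspace (P : Measure Ω) (W : Submodule ℝ (Lp ℝ 2 P)) : Prop :=
  ∀ f ∈ W, P.map f = gaussianReal 0 (‖f‖₊ ^ 2)

lemma IsFractionalBM.isGaussianSubspace [IsProbabilityMeasure P] {H : ℝ} {B : ℝ → Ω → ℝ}
    (hB : IsFractionalBM P H B) :
    IsGaussianSubspace P (Submodule.span ℝ (range hB.vec)).topologicalClosure := by
  intro f hf
  refine closure_minimal (fun f hf => ?_) isClosed_map_eq_gaussianReal hf
  obtain ⟨c, rfl⟩ := Finsupp.mem_span_range_iff_exists_finsupp.1 hf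
  have hae : ⇑(c.sum fun i a => a • hB.vec i : Lp ℝ 2 P)
      =ᵐ[P] fun ω => ∑ i ∈ c.support, c i * B i ω := by
    have h : ∀ᵐ ω ∂P, ∀ i ∈ c.support, hB.vec i ω = B i ω := by
      exact (eventually_all_finset _).2 fun i _ => (hB.memLp i).coeFn_toLp
    filter_upwards [h, Lp_coeFn_sum_smul c.support c hB.vec] with ω h1 h2
    rw [Finsupp.sum, h2]
    exact Finset.sum_congr rfl fun i hi => by rw [h1 i hi]
  refine map_eq_gaussianReal_of_hasGaussianLaw ?_ ?_
  · exact ((hB.gaussian.smul c).hasGaussianLaw_fun_sum (I := c.support)).congr hae.symm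
  · rw [integral_congr_ae hae, integral_finsetSum _ fun i _ =>
      ((hB.memLp i).integrable one_le_two).const_mul _]
    simp [integral_const_mul, hB.centred]

variable {W : Submodule ℝ (Lp ℝ 2 P)}

/-- Every linear functional of finitely many coordinates is again an element of $W$, hence Gaussian.
-/
lemma IsGaussianSubspace.isGaussianProcess [IsProbabilityMeasure P] (hW : IsGaussianSubspace P W) {T : Type*}
    {ξ : T → Lp ℝ 2 P} (hξ : ∀ t, ξ t ∈ W) : IsGaussianProcess (fun t ω => ξ t ω) P := by
  classical
  refine ⟨fun I => ⟨?_⟩⟩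
  have hm : AEMeasurable (fun ω => I.restrict fun t => ξ t ω) P :=
    aemeasurable_pi_lambda _ fun i => (Lp.aestronglyMeasurable (ξ i)).aemeasurable
  refine isGaussian_of_map_eq_gaussianReal fun L => ⟨0, ‖∑ i : I, L (Pi.single i 1) • ξ i‖₊ ^ 2, ?_⟩
  rw [← hW (∑ i : I, L (Pi.single i 1) • ξ i)
      (Submodule.sum_mem _ fun i _ => W.smul_mem _ (hξ i)),
    AEMeasurable.map_map_of_aemeasurable (by fun_prop) hm]
  refine Measure.map_congr ?_
  filter_upwards [Lp_coeFn_sum_smul Finset.univ (fun i : I => L (Pi.single i 1))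
    (fun i : I => ξ i)] with ω hω
  rw [hω, Function.comp_apply, ← L.sum_comp_single]
  refine Finset.sum_congr rfl fun i _ => ?_
  have : (Pi.single i (I.restrict (fun t => ξ t ω) i) : I → ℝ) = (ξ i ω) • Pi.single i 1 := by
    rw [← Pi.single_smul]; simp
  exact (congrArg L this).trans (by rw [map_smul, smul_eq_mul, mul_comm])

lemma IsGaussianSubspace.integral_eq_zero (hW : IsGaussianSubspace P W) {f : Lp ℝ 2 P}
    (hf : f ∈ W) : ∫ ω, f ω ∂P = 0 := by
  have h := integral_map (Lp.aestronglyMeasurable f).aemeasurable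
    (f := fun x : ℝ => x) (by fun_prop)
  rw [← h, hW f hf, integral_id_gaussianReal]

lemma pastSigma_le {B : ℝ → Ω → ℝ} (hB : ∀ t, Measurable (B t)) (k : ℝ) :
    pastSigma B k ≤ mΩ :=
  iSup_le fun r => (hB r).comap_le

/-- A vector of the Gaussian space which is orthogonal to the past is independent of it. -/
lemma IsFractionalBM.indep_of_orthogonal [IsProbabilityMeasure P] {H : ℝ} {B : ℝ → Ω → ℝ} (hB : IsFractionalBM P H B)
    {k : ℝ} {f : Lp ℝ 2 P} (hf : f ∈ (Submodule.span ℝ (range hB.vec)).topologicalClosure)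
    (horth : ∀ r ≤ k, ⟪f, hB.vec r⟫_ℝ = 0) :
    Indep (MeasurableSpace.comap f inferInstance) (pastSigma B k) P := by
  have hW := hB.isGaussianSubspace
  have hm : ∀ r, hB.vec r ∈ (Submodule.span ℝ (range hB.vec)).topologicalClosure := fun r =>
    Submodule.le_topologicalClosure _ (Submodule.subset_span (mem_range_self r))
  -- Adjoining $f$ to the past values keeps the family jointly Gaussian, so vanishing covariances
  -- imply independence.
  have hG : IsGaussianProcess (Sum.elim (fun (_ : Unit) ω => f ω) (fun (r : Iic k) => B r)) P := by
    have := hW.isGaussianProcess (ξ := Sum.elim (fun _ : Unit => f) (fun r : Iic k => hB.vec r))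
      (by rintro (_ | r); exacts [hf, hm r])
    refine this.congr ?_
    rintro (_ | r)
    · exact Eventually.of_forall fun _ => rfl
    · exact (hB.memLp r).coeFn_toLp
  have hI := hG.indepFun_of_covariance_eq_zero
    (fun _ => (Lp.aestronglyMeasurable f).aemeasurable)
    (fun r => (hB.measurable r).aemeasurable) (by
      intro _ r
      rw [covariance_eq_sub (Lp.memLp f) (hB.memLp r), hB.centred, mul_zero, sub_zero,
        ← horth r r.2, ← Lp.toLp_coeFn f (Lp.memLp f), IsFractionalBM.vec,
        inner_toLp_eq_integral]
      refine integral_congr_ae ?_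
      filter_upwards [(Lp.memLp f).coeFn_toLp] with ω hω
      rw [Pi.mul_apply, hω])
  have hI2 : IndepFun f (fun ω (r : Iic k) => B r ω) P :=
    hI.comp (φ := fun x : Unit → ℝ => x ()) (ψ := id) (by fun_prop) measurable_id
  rw [IndepFun_iff_Indep] at hI2
  convert hI2 using 1
  simp only [pastSigma, MeasurableSpace.pi, MeasurableSpace.comap_iSup, MeasurableSpace.comap_comp]
  rfl

end GaussianHilbert

/-- Conditioning on $F$ fixes the measurable part and turns the independent part into its mean,
which is $0$. This is the source of uniqueness. -/
lemma IsLocalIndepDecomposition.ae_eq_condExp {Ω : Type*} {F : MeasurableSpace Ω}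
    [mΩ : MeasurableSpace Ω] {P : Measure Ω} [IsProbabilityMeasure P] (hF : F ≤ mΩ) {Y Ybar Ytil : Ω → ℝ} (h : IsLocalIndepDecomposition P F Y Ybar Ytil)
    (hY : Integrable Y P) (hY0 : ∫ ω, Y ω ∂P = 0) : Ybar =ᵐ[P] P[Y | F] := by
  have hbar : Integrable Ybar P := h.past_memLp.integrable one_le_two
  have htil : Integrable Ytil P := by
    refine (hY.sub hbar).congr ?_
    filter_upwards [h.add_eq] with ω hω
    simp [hω]
  have h0 : ∫ ω, Ytil ω ∂P = 0 := by
    have := integral_congr_ae h.add_eq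
    rw [integral_add hbar htil, hY0, h.past_centred, zero_add] at this
    exact this.symm
  have hm : StronglyMeasurable[MeasurableSpace.comap Ytil inferInstance] Ytil :=
    (comap_measurable Ytil).stronglyMeasurable
  have h1 := condExp_indep_eq h.future_measurable.comap_le hF hm h.future_indep
  have h2 := condExp_add hbar htil F
  have h3 := condExp_congr_ae (m := F) h.add_eq
  have h4 := condExp_of_aestronglyMeasurable' hF h.past_measurable hbar
  filter_upwards [h1, h2, h3, h4] with ω e1 e2 e3 e4
  rw [e3]
  change _ = (P[Ybar + Ytil | F]) ω
  rw [e2, Pi.add_apply, e1, e4, h0, add_zero]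

/-! ### Projection onto the past and its decay -/

section Decomposition

variable {Ω : Type*} [mΩ : MeasurableSpace Ω] {P : Measure Ω} {H σ : ℝ} {B y : ℝ → Ω → ℝ}

/-- The closed linear span in `L²(P)` of a fractional Brownian motion up to time `k`. -/
noncomputable def IsFractionalBM.past (hB : IsFractionalBM P H B) (k : ℝ) :
    Submodule ℝ (Lp ℝ 2 P) :=
  (Submodule.span ℝ (hB.vec '' Iic k)).topologicalClosure

instance (hB : IsFractionalBM P H B) (k : ℝ) : CompleteSpace (hB.past k) :=
  inferInstanceAs (CompleteSpace (Submodule.span ℝ (hB.vec '' Iic k)).topologicalClosure)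

lemma IsFractionalBM.past_le (hB : IsFractionalBM P H B) (k : ℝ) :
    hB.past k ≤ (Submodule.span ℝ (range hB.vec)).topologicalClosure :=
  Submodule.topologicalClosure_mono (Submodule.span_mono (image_subset_range _ _))

lemma IsFractionalBM.vec_mem_past (hB : IsFractionalBM P H B) {r k : ℝ} (h : r ≤ k) :
    hB.vec r ∈ hB.past k :=
  Submodule.le_topologicalClosure _ (Submodule.subset_span (mem_image_of_mem _ h))

/-- The classes with an $\mathcal F_k$-measurable representative form a closed subspace containing
$B_r$ for $r\le k$. -/
lemma IsFractionalBM.aestronglyMeasurable_of_mem_past (hB : IsFractionalBM P H B) {k : ℝ}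
    {f : Lp ℝ 2 P} (hf : f ∈ hB.past k) : AEStronglyMeasurable[pastSigma B k] f P := by
  have hle := pastSigma_le hB.measurable k
  have : hB.past k ≤ lpMeas ℝ ℝ (pastSigma B k) 2 P := by
    refine Submodule.topologicalClosure_minimal _ ?_ (isClosed_aestronglyMeasurable hle)
    rw [Submodule.span_le]
    rintro _ ⟨r, hr, rfl⟩
    rw [SetLike.mem_coe, mem_lpMeas_iff_aestronglyMeasurable]
    have hm : Measurable[pastSigma B k] (B r) :=
      (comap_measurable (B r)).mono
        (le_iSup (fun r : Iic k => MeasurableSpace.comap (B r) inferInstance) ⟨r, hr⟩) le_rfl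
    exact hm.stronglyMeasurable.aestronglyMeasurable.congr (hB.memLp r).coeFn_toLp.symm
  exact mem_lpMeas_iff_aestronglyMeasurable.1 (this hf)

/-- The decomposition of `y t` into its projection on the past and the remainder. -/
lemma IsFractionalBM.isLocalIndepDecomposition [IsProbabilityMeasure P] (hB : IsFractionalBM P H B)
    (hy : IsStationaryFOU P B σ y) (k t : ℝ) :
    IsLocalIndepDecomposition P (pastSigma B k) (y t)
      ((hB.past k).starProjection (hy.vec t))
      (hy.vec t - (hB.past k).starProjection (hy.vec t) : Lp ℝ 2 P) where
  add_eq := by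
    filter_upwards [(hy.memLp t).coeFn_toLp,
      Lp.coeFn_sub (hy.vec t) ((hB.past k).starProjection (hy.vec t))] with ω h1 h2
    rw [h2, Pi.sub_apply, IsStationaryFOU.vec, h1]
    ring
  past_measurable :=
    hB.aestronglyMeasurable_of_mem_past (Submodule.starProjection_apply_mem _ _)
  past_memLp := Lp.memLp _
  past_centred := hB.isGaussianSubspace.integral_eq_zero
    (hB.past_le k (Submodule.starProjection_apply_mem _ _))
  future_measurable := (Lp.stronglyMeasurable _).measurable
  future_indep := by
    refine hB.indep_of_orthogonal ?_ fun r hr => ?_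
    · exact Submodule.sub_mem _ ((hy.isOUVector hB).mem_closure t)
        (hB.past_le k (Submodule.starProjection_apply_mem _ _))
    · exact Submodule.inner_left_of_mem_orthogonal (hB.vec_mem_past hr)
        (Submodule.sub_starProjection_mem_orthogonal _)

lemma IsStationaryFOU.integral_eq_zero (hy : IsStationaryFOU P B σ y) (t : ℝ) :
    ∫ ω, y t ω ∂P = 0 := by
  rw [(hy.law t).integral_eq, integral_id_gaussianReal]

lemma IsFractionalBM.ae_eq_starProjection [IsProbabilityMeasure P] (hB : IsFractionalBM P H B)
    (hy : IsStationaryFOU P B σ y) {k t : ℝ} {ybar ytil : Ω → ℝ}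
    (h : IsLocalIndepDecomposition P (pastSigma B k) (y t) ybar ytil) :
    ybar =ᵐ[P] (hB.past k).starProjection (hy.vec t) := by
  have hle := pastSigma_le hB.measurable k
  have hi := (hy.memLp t).integrable one_le_two
  exact (h.ae_eq_condExp hle hi (hy.integral_eq_zero t)).trans
    ((hB.isLocalIndepDecomposition hy k t).ae_eq_condExp hle hi (hy.integral_eq_zero t)).symm

/-- The norm of the measurable part of `y t` decays like `(t - k) ^ (H - 1)`. -/
lemma IsFractionalBM.exists_norm_starProjection_le (hB : IsFractionalBM P H B)
    (hy : IsStationaryFOU P B σ y) (hH : 1 / 2 < H) (hH1 : H < 1) :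
    ∃ C : ℝ, 0 ≤ C ∧ ∀ k t : ℝ, 0 ≤ k → k + 1 ≤ t →
      ‖(hB.past k).starProjection (hy.vec t)‖ ≤ C * (t - k) ^ (H - 1) := by
  obtain ⟨C, hC, h⟩ := (hy.isOUVector hB).exists_abs_inner_le hB.hasFBMCovariance hH hH1
  refine ⟨C, hC, fun k t hk hkt => ?_⟩
  set z := (hB.past k).starProjection (hy.vec t) with hz
  have hzm : z ∈ hB.past k := Submodule.starProjection_apply_mem _ _
  have h1 := h k t hk hkt z hzm
  -- Testing the correlation bound against the projection itself gives $\|z\|^2\le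
  -- C(t-k)^{H-1}\|z\|$; one factor cancels.
  have h2 : ⟪hy.vec t, z⟫_ℝ = ‖z‖ ^ 2 := by
    have := Submodule.inner_left_of_mem_orthogonal hzm
      (Submodule.sub_starProjection_mem_orthogonal (K := hB.past k) (hy.vec t))
    rw [← hz, inner_sub_left, real_inner_self_eq_norm_sq] at this
    linarith
  rw [h2, abs_of_nonneg (sq_nonneg _), sq] at h1
  rcases (norm_nonneg z).eq_or_lt with h0 | h0
  · rw [← h0]
    exact mul_nonneg hC (Real.rpow_nonneg (by linarith) _)
  · exact le_of_mul_le_mul_right h1 h0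

lemma IsFractionalBM.norm_starProjection_le_one (hB : IsFractionalBM P H B)
    (hy : IsStationaryFOU P B σ y) (k t : ℝ) :
    ‖(hB.past k).starProjection (hy.vec t)‖ ≤ 1 :=
  ((hB.past k).norm_starProjection_apply_le _).trans (hy.norm_vec t).le

end Decomposition

/-! ### Hermite polynomials: Mehler's formula and completeness -/

section Hermite

open Polynomial

lemma integrable_pow_gaussianReal (v : NNReal) (n : ℕ) :
    Integrable (fun x : ℝ => x ^ n) (gaussianReal 0 v) := by
  have h := (memLp_id_gaussianReal (μ := 0) (v := v) n).integrable_norm_pow'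
  refine h.mono' (by fun_prop) (ae_of_all _ fun x => ?_)
  simp

lemma integrable_eval_gaussianReal (v : NNReal) (p : ℝ[X]) :
    Integrable (fun x => p.eval x) (gaussianReal 0 v) := by
  simp only [eval_eq_sum, Polynomial.sum]
  exact integrable_finsetSum _ fun n _ => (integrable_pow_gaussianReal v n).const_mul _

lemma memLp_eval_gaussianReal (v : NNReal) (p : ℝ[X]) :
    MemLp (fun x => p.eval x) 2 (gaussianReal 0 v) := by
  refine (memLp_two_iff_integrable_sq (by fun_prop)).2 ?_
  simp only [← eval_pow]
  exact integrable_eval_gaussianReal v (p ^ 2)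

/-- Gaussian integration by parts for polynomials. -/
lemma integral_mul_eval_gaussianReal (v : NNReal) (p : ℝ[X]) :
    ∫ x, x * p.eval x ∂(gaussianReal 0 v) = v * ∫ x, (derivative p).eval x ∂(gaussianReal 0 v) := by
  -- The Dirac case matters: the remainder of $y_t$ has variance zero when $y_t$ lies in the past.
  rcases eq_or_ne v 0 with rfl | hv
  · simp
  have hv' : (v : ℝ) ≠ 0 := by exact_mod_cast hv
  have hint : ∀ q : ℝ[X], Integrable (fun x => gaussianPDFReal 0 v x * q.eval x) := by
    intro q
    have := integrable_eval_gaussianReal v q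
    rw [gaussianReal_of_var_ne_zero _ hv, integrable_withDensity_iff_integrable_smul'
      (measurable_gaussianPDF _ _) (ae_of_all _ fun _ => gaussianPDF_lt_top)] at this
    simpa using this
  have hderiv : ∀ x, HasDerivAt (fun x => gaussianPDFReal 0 v x * p.eval x)
      (gaussianPDFReal 0 v x * (derivative p - C (v : ℝ)⁻¹ * (X * p)).eval x) x := by
    intro x
    have h1 : HasDerivAt (gaussianPDFReal 0 v) (gaussianPDFReal 0 v x * (-x / v)) x := by
      have h2 : HasDerivAt (fun x : ℝ => -(x - 0) ^ 2 / (2 * v)) (-x / v) x := by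
        have := (((hasDerivAt_id x).sub_const 0).pow 2).neg.div_const (2 * (v : ℝ))
        refine this.congr_deriv ?_
        simp; field_simp
      have := h2.exp.const_mul (√(2 * Real.pi * v))⁻¹
      simp only [gaussianPDFReal_def]
      exact this.congr_deriv (by ring)
    refine (h1.mul (p.hasDerivAt x)).congr_deriv ?_
    simp only [eval_sub, eval_mul, eval_C, eval_X]
    field_simp
    ring
  have h := integral_eq_zero_of_hasDerivAt_of_integrable hderiv (hint _) (hint p)
  have h2 : ∫ x, (derivative p - C (v : ℝ)⁻¹ * (X * p)).eval x ∂(gaussianReal 0 v) = 0 := by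
    rw [integral_gaussianReal_eq_integral_smul hv]
    simpa only [smul_eq_mul] using h
  have h3 := integrable_eval_gaussianReal v (X * p)
  simp only [eval_sub, eval_mul, eval_C, eval_X] at h2 h3
  rw [integral_sub (integrable_eval_gaussianReal v _) (h3.const_mul _), integral_const_mul,
    sub_eq_zero] at h2
  rw [h2]
  field_simp

/-- The Hermite polynomials with real coefficients. -/
noncomputable def realHermite (n : ℕ) : ℝ[X] := (hermite n).map (Int.castRingHom ℝ)

lemma aeval_hermite (n : ℕ) (x : ℝ) : aeval x (hermite n) = (realHermite n).eval x := by
  rw [realHermite, ← algebraMap_int_eq, eval_map_algebraMap]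

lemma realHermite_zero : realHermite 0 = 1 := by simp [realHermite]

lemma realHermite_succ (n : ℕ) :
    realHermite (n + 1) = X * realHermite n - derivative (realHermite n) := by
  simp [realHermite, hermite_succ, derivative_map]

lemma derivative_realHermite_succ (n : ℕ) :
    derivative (realHermite (n + 1)) = ((n + 1 : ℕ) : ℝ[X]) * realHermite n := by
  induction n with
  | zero => simp [realHermite_succ, realHermite_zero]
  | succ n ih =>
    rw [realHermite_succ (n + 1), derivative_sub, derivative_mul, derivative_X, ih, derivative_mul,
      derivative_natCast, realHermite_succ n]
    push_cast
    ring

lemma realHermite_add_two (n : ℕ) :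
    realHermite (n + 2) = X * realHermite (n + 1) - ((n + 1 : ℕ) : ℝ[X]) * realHermite n := by
  rw [realHermite_succ (n + 1), derivative_realHermite_succ]

/-- The raising operator $p\mapsto Xp-p'$ is the Gaussian adjoint of differentiation; iterating this
gives orthogonality. -/
lemma integral_realHermite_succ_mul (n : ℕ) (q : ℝ[X]) :
    ∫ x, (realHermite (n + 1)).eval x * q.eval x ∂(gaussianReal 0 1)
      = ∫ x, (realHermite n).eval x * (derivative q).eval x ∂(gaussianReal 0 1) := by
  have h := integral_mul_eval_gaussianReal 1 (realHermite n * q)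
  have i1 := integrable_eval_gaussianReal 1 (derivative (realHermite n) * q)
  have i2 := integrable_eval_gaussianReal 1 (realHermite n * derivative q)
  have i3 := integrable_eval_gaussianReal 1 (X * realHermite n * q)
  simp only [derivative_mul, eval_add, eval_mul, eval_X] at h i1 i2 i3
  rw [integral_add i1 i2] at h
  simp only [realHermite_succ, eval_sub, eval_mul, eval_X, sub_mul]
  rw [integral_sub i3 i1]
  simp only [mul_assoc]
  rw [h]
  simp

lemma integral_realHermite_mul (n l : ℕ) :
    ∫ x, (realHermite n).eval x * (realHermite l).eval x ∂(gaussianReal 0 1)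
      = if n = l then (n.factorial : ℝ) else 0 := by
  induction n generalizing l with
  | zero =>
    cases l with
    | zero => simp [realHermite_zero]
    | succ l =>
      have := integral_realHermite_succ_mul l 1
      simpa [realHermite_zero] using this
  | succ n ih =>
    rw [integral_realHermite_succ_mul]
    cases l with
    | zero => simp [realHermite_zero]
    | succ l =>
      rw [derivative_realHermite_succ]
      simp only [eval_mul, eval_natCast, mul_left_comm _ ((l + 1 : ℕ) : ℝ)]
      rw [integral_const_mul, ih]
      by_cases h : n = l
      · subst h; simp [Nat.factorial_succ]
      · simp [h]

/-- Mehler's formula for Hermite polynomials. -/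
lemma integral_realHermite_add (n : ℕ) {ρ : ℝ} {v : NNReal} (hv : (v : ℝ) = 1 - ρ ^ 2) (x : ℝ) :
    ∫ z, (realHermite n).eval (ρ * x + z) ∂(gaussianReal 0 v) = ρ ^ n * (realHermite n).eval x := by
  have e : ∀ (p : ℝ[X]) (z : ℝ), p.eval (ρ * x + z) = (p.comp (C (ρ * x) + X)).eval z := by
    intro p z; simp [eval_comp]
  induction n using Nat.twoStepInduction with
  | zero => simp [realHermite_zero]
  | one =>
    have h1 : realHermite 1 = X := by simp [realHermite]
    have i := integrable_pow_gaussianReal v 1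
    simp only [pow_one] at i
    simp only [h1, eval_X, pow_one]
    rw [integral_add (integrable_const _) i]
    simp
  | more n ih1 ih2 =>
    have i1 := integrable_eval_gaussianReal v ((realHermite (n + 1)).comp (C (ρ * x) + X))
    have i2 := integrable_eval_gaussianReal v ((realHermite n).comp (C (ρ * x) + X))
    have i3 := integrable_eval_gaussianReal v (X * (realHermite (n + 1)).comp (C (ρ * x) + X))
    have hS := integral_mul_eval_gaussianReal v ((realHermite (n + 1)).comp (C (ρ * x) + X))
    rw [derivative_comp, derivative_realHermite_succ] at hS
    simp only [derivative_add, derivative_C, derivative_X, zero_add, one_mul, mul_comp,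
      natCast_comp, eval_mul, eval_natCast, eval_X, ← e, integral_const_mul] at hS i1 i2 i3
    rw [ih1] at hS
    -- Integration by parts turns the term with factor $z$ into $(1-\rho^2)(n+1)\rho^nH_n(x)$. Its
    -- part without $\rho^2$ cancels the last term, leaving $\rho^{n+2}$ times the recurrence at
    -- $x$.
    have h : ∀ z, (realHermite (n + 2)).eval (ρ * x + z)
        = (ρ * x) * (realHermite (n + 1)).eval (ρ * x + z)
          + z * (realHermite (n + 1)).eval (ρ * x + z)
          - ((n + 1 : ℕ) : ℝ) * (realHermite n).eval (ρ * x + z) := by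
      intro z
      rw [realHermite_add_two]
      simp only [eval_sub, eval_mul, eval_X, eval_natCast]
      ring
    simp_rw [h]
    have i4 : Integrable (fun z => (ρ * x) * (realHermite (n + 1)).eval (ρ * x + z)
          + z * (realHermite (n + 1)).eval (ρ * x + z)) (gaussianReal 0 v) :=
      (i1.const_mul _).add i3
    rw [integral_sub i4 (i2.const_mul _), integral_add (i1.const_mul _) i3,
      integral_const_mul, integral_const_mul, ih1, ih2, hS, hv, realHermite_add_two]
    simp only [eval_sub, eval_mul, eval_X, eval_natCast]
    ring

/-- By the three-term recurrence the span is stable under multiplication by $X$. -/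
lemma X_pow_mem_span_realHermite (n : ℕ) :
    (X ^ n : ℝ[X]) ∈ Submodule.span ℝ (range realHermite) := by
  have hX : ∀ p ∈ Submodule.span ℝ (range realHermite),
      X * p ∈ Submodule.span ℝ (range realHermite) := by
    intro p hp
    induction hp using Submodule.span_induction with
    | mem p hp =>
      obtain ⟨n, rfl⟩ := hp
      have hm : ∀ j, realHermite j ∈ Submodule.span ℝ (range realHermite) := fun j =>
        Submodule.subset_span (mem_range_self j)
      cases n with
      | zero =>
        have h1 : realHermite 1 = X * realHermite 0 := by simp [realHermite]
        exact h1 ▸ hm 1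
      | succ n =>
        have h1 : X * realHermite (n + 1)
            = realHermite (n + 2) + ((n + 1 : ℕ) : ℝ) • realHermite n := by
          rw [realHermite_add_two, smul_eq_C_mul, ← C_eq_natCast]
          simp
        exact h1 ▸ Submodule.add_mem _ (hm _) (Submodule.smul_mem _ _ (hm _))
    | zero => simp
    | add p q _ _ hp hq => rw [mul_add]; exact Submodule.add_mem _ hp hq
    | smul c p _ hp => rw [mul_smul_comm]; exact Submodule.smul_mem _ _ hp
  induction n with
  | zero =>
    rw [pow_zero, ← realHermite_zero]
    exact Submodule.subset_span (mem_range_self 0)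
  | succ n ih => rw [pow_succ']; exact hX _ ih

/-- Finite measures on `ℝ` with all exponential moments are determined by their moments. -/
lemma ext_of_moments {μ ν : Measure ℝ} [IsFiniteMeasure μ] [IsFiniteMeasure ν]
    (hμ : integrableExpSet id μ = univ) (hν : integrableExpSet id ν = univ)
    (h : ∀ n : ℕ, ∫ x, x ^ n ∂μ = ∫ x, x ^ n ∂ν) : μ = ν := by
  have h1 := hasFPowerSeriesAt_mgf (X := id) (μ := μ) (v := 0) (by simp [hμ])
  have h2 := hasFPowerSeriesAt_mgf (X := id) (μ := ν) (v := 0) (by simp [hν])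
  simp only [id, zero_mul, Real.exp_zero, mul_one, h] at h1 h2
  -- Equal moments give equal power series at $0$; analyticity extends the equality to the whole
  -- line, then to the complex generating functions.
  have h3 : mgf id μ =ᶠ[𝓝 0] mgf id ν := by
    filter_upwards [h1.eventually_hasSum_sub, h2.eventually_hasSum_sub] with x e1 e2
    exact e1.unique e2
  have a1 : AnalyticOnNhd ℝ (mgf id μ) univ := by
    simpa [hμ] using analyticOnNhd_mgf (X := id) (μ := μ)
  have a2 : AnalyticOnNhd ℝ (mgf id ν) univ := by
    simpa [hν] using analyticOnNhd_mgf (X := id) (μ := ν)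
  have h4 : mgf id μ = mgf id ν := a1.eq_of_eventuallyEq a2 h3
  have h5 : μ = 0 ↔ ν = 0 := by
    have := congrFun h4 0
    simp only [mgf_zero'] at this
    rw [← Measure.measure_univ_eq_zero, ← Measure.measure_univ_eq_zero, ← measureReal_eq_zero_iff,
      ← measureReal_eq_zero_iff, this]
  refine Measure.ext_of_complexMGF_id_eq (funext fun z => ?_)
  exact eqOn_complexMGF_of_mgf' h4 h5 (by simp [hμ])

lemma memLp_exp_mul_gaussianReal (t : ℝ) :
    MemLp (fun x => Real.exp (t * x)) 2 (gaussianReal 0 1) := by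
  refine (memLp_two_iff_integrable_sq (by fun_prop)).2 ?_
  refine (integrable_exp_mul_gaussianReal (μ := 0) (v := 1) (2 * t)).congr (ae_of_all _ fun x => ?_)
  simp only [← Real.exp_nat_mul]
  push_cast; ring_nf

/-- A square integrable function orthogonal to all monomials for the Gaussian measure vanishes. -/
lemma ae_eq_zero_of_integral_mul_pow_eq_zero {f : ℝ → ℝ} (hf : MemLp f 2 (gaussianReal 0 1))
    (hfm : Measurable f) (h : ∀ n : ℕ, ∫ x, f x * x ^ n ∂(gaussianReal 0 1) = 0) :
    f =ᵐ[gaussianReal 0 1] 0 := by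
  -- The positive and negative parts of $f$ serve as densities of two finite measures with equal
  -- moments. Exponential moments exist because $f$ and $e^{tx}$ are both in $L^2$.
  have hpos : ∀ g : ℝ → ℝ, MemLp g 2 (gaussianReal 0 1) →
      MemLp (fun x => ((g x).toNNReal : ℝ)) 2 (gaussianReal 0 1) := by
    intro g hg
    refine hg.of_le ?_ (ae_of_all _ fun x => ?_)
    · exact (continuous_real_toNNReal.subtype_val).comp_aestronglyMeasurable hg.1
    · simp only [Real.coe_toNNReal', Real.norm_eq_abs]
      rw [abs_of_nonneg (le_max_right _ _)]
      exact max_le (le_abs_self _) (abs_nonneg _)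
  have hexp : ∀ g : ℝ → ℝ, MemLp g 2 (gaussianReal 0 1) → Measurable g →
      integrableExpSet id ((gaussianReal 0 1).withDensity fun x => (g x).toNNReal) = univ := by
    intro g hg hgm
    refine eq_univ_of_forall fun t => ?_
    change Integrable _ _
    rw [integrable_withDensity_iff_integrable_smul hgm.real_toNNReal]
    exact (hpos g hg).integrable_mul (memLp_exp_mul_gaussianReal t)
  have hfin : ∀ g : ℝ → ℝ, MemLp g 2 (gaussianReal 0 1) →
      IsFiniteMeasure ((gaussianReal 0 1).withDensity fun x => ((g x).toNNReal : ENNReal)) :=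
    fun g hg => isFiniteMeasure_withDensity_ofReal (hg.integrable one_le_two).2
  have hpow : ∀ n : ℕ, MemLp (fun x : ℝ => x ^ n) 2 (gaussianReal 0 1) := fun n => by
    simpa using memLp_eval_gaussianReal 1 (X ^ n)
  have hfn : MemLp (fun x => -f x) 2 (gaussianReal 0 1) := hf.neg
  have hfnm : Measurable (fun x => -f x) := hfm.neg
  have := hfin f hf
  have := hfin _ hfn
  have key := ext_of_moments (hexp f hf hfm) (hexp _ hfn hfnm) (by
    intro n
    rw [integral_withDensity_eq_integral_smul hfm.real_toNNReal,
      integral_withDensity_eq_integral_smul hfnm.real_toNNReal]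
    refine sub_eq_zero.1 (Eq.trans ?_ (h n))
    refine (integral_sub ((hpos f hf).integrable_mul (hpow n))
      ((hpos _ hfn).integrable_mul (hpow n))).symm.trans ?_
    refine integral_congr_ae (ae_of_all _ fun x => ?_)
    change ((f x).toNNReal : ℝ) * x ^ n - ((-f x).toNNReal : ℝ) * x ^ n = f x * x ^ n
    rw [← sub_mul, Real.coe_toNNReal', Real.coe_toNNReal', max_zero_sub_max_neg_zero_eq_self])
  rw [withDensity_eq_iff_of_sigmaFinite (by fun_prop) (by fun_prop)] at key
  filter_upwards [key] with x hx
  have hx' : (f x).toNNReal = (-f x).toNNReal := by exact_mod_cast hx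
  rcases le_total 0 (f x) with h0 | h0
  · rw [Real.toNNReal_of_nonpos (by linarith : -f x ≤ 0), Real.toNNReal_eq_zero] at hx'
    exact le_antisymm hx' h0
  · rw [Real.toNNReal_of_nonpos h0, eq_comm, Real.toNNReal_eq_zero] at hx'
    exact le_antisymm h0 (neg_nonpos.1 hx')

/-- The normalised Hermite polynomials as vectors of `L²(N(0,1))`. -/
noncomputable def hermiteVec (n : ℕ) : Lp ℝ 2 (gaussianReal 0 1) :=
  (√n.factorial)⁻¹ • (memLp_eval_gaussianReal 1 (realHermite n)).toLp _

lemma orthonormal_hermiteVec : Orthonormal ℝ hermiteVec := by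
  rw [orthonormal_iff_ite]
  intro n l
  have hn : (0 : ℝ) < n.factorial := by exact_mod_cast n.factorial_pos
  rw [hermiteVec, hermiteVec, real_inner_smul_left, real_inner_smul_right, inner_toLp_eq_integral,
    integral_realHermite_mul]
  by_cases h : n = l
  · subst h
    simp only [if_true]
    rw [← mul_assoc, ← mul_inv, Real.mul_self_sqrt hn.le, inv_mul_cancel₀ hn.ne']
  · simp [h]

lemma span_hermiteVec_orthogonal : (Submodule.span ℝ (range hermiteVec))ᗮ = ⊥ := by
  rw [Submodule.eq_bot_iff]
  intro f hf
  have h1 : ∀ n, ∫ x, f x * (realHermite n).eval x ∂(gaussianReal 0 1) = 0 := by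
    intro n
    have := Submodule.inner_left_of_mem_orthogonal
      (Submodule.subset_span (mem_range_self n)) hf
    have hn : (√(n.factorial : ℝ))⁻¹ ≠ 0 := by positivity
    rw [hermiteVec, real_inner_smul_right, mul_eq_zero, or_iff_right hn,
      ← Lp.toLp_coeFn f (Lp.memLp f), inner_toLp_eq_integral] at this
    exact this
  have h2 : ∀ p ∈ Submodule.span ℝ (range realHermite),
      ∫ x, f x * p.eval x ∂(gaussianReal 0 1) = 0 := by
    intro p hp
    have hi : ∀ q : ℝ[X], Integrable (fun x => f x * q.eval x) (gaussianReal 0 1) := fun q =>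
      (Lp.memLp f).integrable_mul (memLp_eval_gaussianReal 1 q)
    induction hp using Submodule.span_induction with
    | mem p hp => obtain ⟨n, rfl⟩ := hp; exact h1 n
    | zero => simp
    | add p q _ _ hp hq =>
      simp only [eval_add, mul_add]
      rw [integral_add (hi p) (hi q), hp, hq, add_zero]
    | smul c p _ hp =>
      simp only [eval_smul, smul_eq_mul, mul_left_comm _ c]
      rw [integral_const_mul, hp, mul_zero]
  have h3 := ae_eq_zero_of_integral_mul_pow_eq_zero (Lp.memLp f) (Lp.stronglyMeasurable f).measurable
    (fun n => by simpa using h2 _ (X_pow_mem_span_realHermite n))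
  exact (Lp.eq_zero_iff_ae_eq_zero).2 h3

/-- The Hilbert basis of `L²(N(0,1))` formed by the normalised Hermite polynomials. -/
noncomputable def hermiteBasis : HilbertBasis ℕ ℝ (Lp ℝ 2 (gaussianReal 0 1)) :=
  HilbertBasis.mkOfOrthogonalEqBot orthonormal_hermiteVec span_hermiteVec_orthogonal

lemma hermiteBasis_apply (n : ℕ) : hermiteBasis n = hermiteVec n := by
  simp [hermiteBasis]

end Hermite

/-! ### Conditional expectation as a diagonal contraction -/

lemma sq_norm_sum_smul_of_orthogonal {G : Type*} [NormedAddCommGroup G] [InnerProductSpace ℝ G]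
    {v : ℕ → G} {g : ℕ → ℝ} (hv : ∀ n l, ⟪v n, v l⟫_ℝ = if n = l then g n else 0) (s : Finset ℕ)
    (c : ℕ → ℝ) : ‖∑ i ∈ s, c i • v i‖ ^ 2 = ∑ i ∈ s, c i ^ 2 * g i := by
  rw [← real_inner_self_eq_norm_sq, sum_inner]
  refine Finset.sum_congr rfl fun i hi => ?_
  simp only [inner_sum, real_inner_smul_left, real_inner_smul_right, hv, mul_ite, mul_zero]
  rw [Finset.sum_ite_eq, if_pos hi]
  ring

/-- An operator which is diagonal with entries `ρ ^ n` up to an orthonormal change of the target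
basis contracts by `ρ ^ m` on the vectors without components of index less than `m`. -/
lemma HilbertBasis.norm_apply_le_pow_mul {E F : Type*} [NormedAddCommGroup E]
    [InnerProductSpace ℝ E] [NormedAddCommGroup F] [InnerProductSpace ℝ F]
    (e : HilbertBasis ℕ ℝ E) (L : E →L[ℝ] F) {ρ : ℝ} (hρ : 0 ≤ ρ) (hρ1 : ρ ≤ 1)
    (hL : ∀ n l, ⟪L (e n), L (e l)⟫_ℝ = if n = l then (ρ ^ n) ^ 2 else 0) {m : ℕ} {u : E}
    (hu : ∀ n < m, ⟪e n, u⟫_ℝ = 0) : ‖L u‖ ≤ ρ ^ m * ‖u‖ := by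
  have hsum := e.hasSum_repr u
  refine le_of_tendsto_of_tendsto' (L.continuous.tendsto u |>.comp hsum).norm
    (hsum.norm.const_mul (ρ ^ m)) fun s => ?_
  refine le_of_sq_le_sq ?_ (by positivity)
  simp only [Function.comp_apply, map_sum, map_smul]
  rw [sq_norm_sum_smul_of_orthogonal hL, mul_pow, sq_norm_sum_smul_of_orthogonal (g := fun _ => 1)
    (orthonormal_iff_ite.1 e.orthonormal), Finset.mul_sum]
  refine Finset.sum_le_sum fun i _ => ?_
  rcases lt_or_ge i m with him | him
  · rw [e.repr_apply_apply, hu i him]; simp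
  · have : (ρ ^ i) ^ 2 ≤ (ρ ^ m) ^ 2 :=
      pow_le_pow_left₀ (by positivity) (pow_le_pow_of_le_one hρ hρ1 him) 2
    nlinarith [mul_le_mul_of_nonneg_left this (sq_nonneg (e.repr u i))]

section CondExp

/-- The conditional expectation of a polynomial of the sum of a measurable and an independent
Gaussian variable. -/
lemma condExp_eval_add {Ω : Type*} {F : MeasurableSpace Ω} [mΩ : MeasurableSpace Ω] {P : Measure Ω}
    [IsProbabilityMeasure P] (hF : F ≤ mΩ) {X Z : Ω → ℝ} (hX : AEStronglyMeasurable[F] X P)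
    (hXm : AEMeasurable X P) (hZm : Measurable Z) {a v : NNReal} (hXlaw : P.map X = gaussianReal 0 a)
    (hZlaw : P.map Z = gaussianReal 0 v)
    (hind : Indep (MeasurableSpace.comap Z inferInstance) F P) (p : Polynomial ℝ) :
    P[fun ω => p.eval (X ω + Z ω) | F]
      =ᵐ[P] fun ω => ∫ z, p.eval (X ω + z) ∂(gaussianReal 0 v) := by
  -- Taylor expansion makes each term a product of an $F$-measurable factor and a factor independent
  -- of $F$.
  have hexp : ∀ x z, p.eval (x + z)
      = ∑ i ∈ Finset.range (p.natDegree + 1), (p.hasseDeriv i).eval x * z ^ i := by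
    intro x z
    rw [add_comm, ← Polynomial.taylor_eval, Polynomial.eval_eq_sum_range,
      Polynomial.natDegree_taylor]
    simp only [Polynomial.taylor_coeff]
  have hq : ∀ q : Polynomial ℝ, MemLp (fun ω => q.eval (X ω)) 2 P := fun q =>
    (memLp_map_measure_iff (g := fun x => q.eval x) (by fun_prop) hXm).1
      (hXlaw ▸ memLp_eval_gaussianReal a q)
  have hz : ∀ i : ℕ, MemLp (fun ω => Z ω ^ i) 2 P := fun i => by
    refine (memLp_map_measure_iff (g := fun x => x ^ i) (by fun_prop) hZm.aemeasurable).1 ?_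
    rw [hZlaw]
    simpa using memLp_eval_gaussianReal v (Polynomial.X ^ i)
  have hprod : ∀ i : ℕ, Integrable ((fun ω => (p.hasseDeriv i).eval (X ω)) * fun ω => Z ω ^ i) P :=
    fun i => (hq _).integrable_mul (hz i)
  have hterm : ∀ i : ℕ, P[(fun ω => (p.hasseDeriv i).eval (X ω)) * fun ω => Z ω ^ i | F]
      =ᵐ[P] fun ω => (p.hasseDeriv i).eval (X ω) * ∫ z, z ^ i ∂(gaussianReal 0 v) := by
    intro i
    have h1 := condExp_mul_of_aestronglyMeasurable_left (m := F)
      ((Polynomial.continuous (p.hasseDeriv i)).comp_aestronglyMeasurable hX) (hprod i)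
      ((hz i).integrable one_le_two)
    have hsm : StronglyMeasurable[MeasurableSpace.comap Z inferInstance] fun ω => Z ω ^ i :=
      ((comap_measurable Z).pow_const i).stronglyMeasurable
    have h2 := condExp_indep_eq hZm.comap_le hF hsm hind
    filter_upwards [h1, h2] with ω e1 e2
    refine e1.trans ?_
    rw [Pi.mul_apply, e2, ← hZlaw, integral_map hZm.aemeasurable (by fun_prop)]
  have hfun : (fun ω => p.eval (X ω + Z ω)) = ∑ i ∈ Finset.range (p.natDegree + 1),
      ((fun ω => (p.hasseDeriv i).eval (X ω)) * fun ω => Z ω ^ i) := by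
    ext ω
    rw [hexp, Finset.sum_apply]
    rfl
  rw [hfun]
  have h3 := condExp_finsetSum (s := Finset.range (p.natDegree + 1)) (fun i _ => hprod i) F
  have h4 : ∀ᵐ ω ∂P, ∀ i : ℕ, (P[(fun ω => (p.hasseDeriv i).eval (X ω)) * fun ω => Z ω ^ i | F]) ω
      = (p.hasseDeriv i).eval (X ω) * ∫ z, z ^ i ∂(gaussianReal 0 v) := ae_all_iff.2 hterm
  filter_upwards [h3, h4] with ω e3 e4
  rw [e3, Finset.sum_apply]
  simp only [hexp, e4]
  rw [integral_finsetSum _ fun i _ => (integrable_pow_gaussianReal v i).const_mul _]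
  simp only [integral_const_mul]

/-- The operator `U ↦ E(U(X) | F)` from `L²(N(0,1))` to `L²(P)` for a standard Gaussian `X`. -/
noncomputable def condExpComp {Ω : Type*} {F : MeasurableSpace Ω} [mΩ : MeasurableSpace Ω]
    {P : Measure Ω} (hF : F ≤ mΩ) {X : Ω → ℝ} (hX : MeasurePreserving X P (gaussianReal 0 1)) :
    Lp ℝ 2 (gaussianReal 0 1) →L[ℝ] Lp ℝ 2 P :=
  (lpMeas ℝ ℝ F 2 P).subtypeL ∘L condExpL2 ℝ ℝ hF ∘L
    (Lp.compMeasurePreservingₗᵢ ℝ X hX).toContinuousLinearMap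

lemma condExpComp_toLp_ae_eq {Ω : Type*} {F : MeasurableSpace Ω} [mΩ : MeasurableSpace Ω]
    {P : Measure Ω} [IsProbabilityMeasure P] (hF : F ≤ mΩ) {X : Ω → ℝ}
    (hX : MeasurePreserving X P (gaussianReal 0 1)) {U : ℝ → ℝ} (hU : MemLp U 2 (gaussianReal 0 1)) :
    condExpComp hF hX (hU.toLp U) =ᵐ[P] P[U ∘ X | F] :=
  (hU.comp_measurePreserving hX).condExpL2_ae_eq_condExp (𝕜 := ℝ) hF

end CondExp

section FOU

variable {Ω : Type*} [mΩ : MeasurableSpace Ω] {P : Measure Ω} {H σ : ℝ} {B y : ℝ → Ω → ℝ}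

lemma IsFractionalBM.norm_vec_neg_one (hB : IsFractionalBM P H B) (hH : 0 < H) :
    ‖hB.vec (-1)‖ = 1 := by
  have h := hB.hasFBMCovariance (-1) (-1)
  rw [real_inner_self_eq_norm_sq] at h
  simp only [sub_self, abs_zero, Real.zero_rpow (by linarith : 2 * H ≠ 0), abs_neg, abs_one,
    Real.one_rpow] at h
  nlinarith [norm_nonneg (hB.vec (-1))]

lemma IsFractionalBM.measurePreserving [IsProbabilityMeasure P] (hB : IsFractionalBM P H B) {f : Lp ℝ 2 P}
    (hf : f ∈ (Submodule.span ℝ (range hB.vec)).topologicalClosure) (h1 : ‖f‖ = 1) :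
    MeasurePreserving f P (gaussianReal 0 1) := by
  refine ⟨(Lp.stronglyMeasurable f).measurable, ?_⟩
  rw [hB.isGaussianSubspace f hf, show ‖f‖₊ = 1 from NNReal.eq h1, one_pow]

lemma IsFractionalBM.measurePreserving_vec [IsProbabilityMeasure P] (hB : IsFractionalBM P H B)
    (hy : IsStationaryFOU P B σ y) (t : ℝ) :
    MeasurePreserving (hy.vec t) P (gaussianReal 0 1) :=
  hB.measurePreserving ((hy.isOUVector hB).mem_closure t) (hy.norm_vec t)

/-- When $z=0$ a unit direction is still required; $B_{-1}$ is one, and it belongs to the past since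
$k\ge0$. -/
lemma IsFractionalBM.exists_eq_norm_smul (hB : IsFractionalBM P H B) (hH : 0 < H) {k : ℝ}
    (hk : 0 ≤ k) {z : Lp ℝ 2 P} (hz : z ∈ hB.past k) :
    ∃ x ∈ hB.past k, ‖x‖ = 1 ∧ z = ‖z‖ • x := by
  rcases eq_or_ne z 0 with rfl | h0
  · exact ⟨hB.vec (-1), hB.vec_mem_past (by linarith), hB.norm_vec_neg_one hH, by simp⟩
  · have h : ‖z‖ ≠ 0 := norm_ne_zero_iff.2 h0
    refine ⟨‖z‖⁻¹ • z, Submodule.smul_mem _ _ hz, ?_, ?_⟩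
    · rw [norm_smul, norm_inv, norm_norm, inv_mul_cancel₀ h]
    · rw [smul_smul, mul_inv_cancel₀ h, one_smul]

/-- The conditional expectation given the past contracts the Hermite modes of order at least `m`
by the `m`-th power of the norm of the measurable part. -/
lemma IsFractionalBM.norm_condExpComp_le [IsProbabilityMeasure P] (hB : IsFractionalBM P H B)
    (hy : IsStationaryFOU P B σ y) (hH : 0 < H) {k : ℝ} (hk : 0 ≤ k) (t : ℝ) {m : ℕ}
    {u : Lp ℝ 2 (gaussianReal 0 1)} (hu : ∀ n < m, ⟪hermiteVec n, u⟫_ℝ = 0) :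
    ‖condExpComp (pastSigma_le hB.measurable k) (hB.measurePreserving_vec hy t) u‖
      ≤ ‖(hB.past k).starProjection (hy.vec t)‖ ^ m * ‖u‖ := by
  set hF := pastSigma_le hB.measurable k
  set hY := hB.measurePreserving_vec hy t
  set z := (hB.past k).starProjection (hy.vec t) with hz
  have hzm : z ∈ hB.past k := Submodule.starProjection_apply_mem _ _
  obtain ⟨x, hxm, hx1, hzx⟩ := hB.exists_eq_norm_smul hH hk hzm
  have hX := hB.measurePreserving (hB.past_le k hxm) hx1
  have hdec := hB.isLocalIndepDecomposition hy k t
  rw [← hz] at hdec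
  set w := hy.vec t - z with hw
  have hwm : w ∈ (Submodule.span ℝ (range hB.vec)).topologicalClosure :=
    Submodule.sub_mem _ ((hy.isOUVector hB).mem_closure t) (hB.past_le k hzm)
  have hwlaw := hB.isGaussianSubspace w hwm
  have hzlaw := hB.isGaussianSubspace z (hB.past_le k hzm)
  have hv : ((‖w‖₊ ^ 2 : NNReal) : ℝ) = 1 - ‖z‖ ^ 2 := by
    have h1 : ⟪w, z⟫_ℝ = 0 := Submodule.inner_left_of_mem_orthogonal hzm
      (Submodule.sub_starProjection_mem_orthogonal (K := hB.past k) (hy.vec t))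
    have h2 : hy.vec t = w + z := by rw [hw]; abel
    have h3 := norm_add_sq_real w z
    rw [← h2, hy.norm_vec, h1] at h3
    push_cast
    linarith
  -- Mehler's formula with $\rho=\|z\|$: the remainder $w$ has variance $1-\rho^2$ by Pythagoras.
  have key : ∀ n, condExpComp hF hY ((memLp_eval_gaussianReal 1 (realHermite n)).toLp _)
      = ‖z‖ ^ n • Lp.compMeasurePreservingₗᵢ ℝ x hX
          ((memLp_eval_gaussianReal 1 (realHermite n)).toLp _) := by
    intro n
    have hmem := memLp_eval_gaussianReal 1 (realHermite n)
    refine Lp.ext ((condExpComp_toLp_ae_eq hF hY hmem).trans ?_)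
    have e1 := condExp_eval_add hF hdec.past_measurable (Lp.aestronglyMeasurable z).aemeasurable
      hdec.future_measurable hzlaw hwlaw hdec.future_indep (realHermite n)
    have e2 : (fun x => (realHermite n).eval x) ∘ hy.vec t
        =ᵐ[P] fun ω => (realHermite n).eval (z ω + w ω) := by
      filter_upwards [Lp.coeFn_sub (hy.vec t) z] with ω hω
      rw [← hw] at hω
      rw [hω]
      simp
    have e3 : ⇑z =ᵐ[P] fun ω => ‖z‖ * x ω := by
      conv_lhs => rw [hzx]
      filter_upwards [Lp.coeFn_smul ‖z‖ x] with ω hω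
      rw [hω]; rfl
    have e4 : ⇑(Lp.compMeasurePreservingₗᵢ ℝ x hX (hmem.toLp _))
        =ᵐ[P] fun ω => (realHermite n).eval (x ω) :=
      (hmem.comp_measurePreserving hX).coeFn_toLp
    refine (condExp_congr_ae e2).trans (e1.trans ?_)
    filter_upwards [e3, e4, Lp.coeFn_smul (‖z‖ ^ n)
      (Lp.compMeasurePreservingₗᵢ ℝ x hX (hmem.toLp _))] with ω h3 h4 h5
    rw [h3, h5, Pi.smul_apply, h4, integral_realHermite_add n hv, smul_eq_mul]
  have key2 : ∀ n, condExpComp hF hY (hermiteBasis n)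
      = ‖z‖ ^ n • Lp.compMeasurePreservingₗᵢ ℝ x hX (hermiteBasis n) := by
    intro n
    rw [hermiteBasis_apply, hermiteVec, map_smul, map_smul, key, smul_comm]
  refine hermiteBasis.norm_apply_le_pow_mul _ (norm_nonneg z)
    (hB.norm_starProjection_le_one hy k t) (fun n l => ?_) (fun n hn => ?_)
  · rw [key2, key2, real_inner_smul_left, real_inner_smul_right, LinearIsometry.inner_map_map,
      orthonormal_iff_ite.1 hermiteBasis.orthonormal]
    by_cases h : n = l
    · subst h; simp [sq]
    · simp [h]
  · rw [hermiteBasis_apply, hu n hn]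

end FOU

/-! ### $L^2$-continuity of $r\mapsto U(y_r)$ -/

lemma exists_dist_le_add_mul_of_hasCompactSupport {g : ℝ → ℝ} (hg : Continuous g)
    (hgc : HasCompactSupport g) {ε : ℝ} (hε : 0 < ε) :
    ∃ K : ℝ, 0 ≤ K ∧ ∀ a b, |g a - g b| ≤ ε + K * |a - b| := by
  obtain ⟨M, hM⟩ := hgc.exists_bound_of_continuous hg
  obtain ⟨δ, hδ, h⟩ := Metric.uniformContinuous_iff.1
    (hgc.uniformContinuous_of_continuous hg) ε hε
  have hM0 : 0 ≤ M := (norm_nonneg _).trans (hM 0)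
  refine ⟨2 * M / δ, by positivity, fun a b => ?_⟩
  by_cases hab : |a - b| < δ
  · have := (h (a := a) (b := b) hab).le
    rw [Real.dist_eq] at this
    have h2 : 0 ≤ 2 * M / δ * |a - b| := by positivity
    linarith
  · have h1 : |g a - g b| ≤ 2 * M :=
      (abs_sub _ _).trans (by
        have h1 := hM a
        have h2 := hM b
        rw [Real.norm_eq_abs] at h1 h2
        linarith)
    have h2 : 2 * M / δ * δ ≤ 2 * M / δ * |a - b| :=
      mul_le_mul_of_nonneg_left (not_lt.1 hab) (by positivity)
    rw [div_mul_cancel₀ _ hδ.ne'] at h2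
    linarith

lemma norm_toLp_comp_sub_le {Ω : Type*} [MeasurableSpace Ω] {P : Measure Ω}
    [IsProbabilityMeasure P] {g : ℝ → ℝ} {ε K : ℝ} (hε : 0 ≤ ε) (hK : 0 ≤ K)
    (hg : ∀ a b, |g a - g b| ≤ ε + K * |a - b|) {X Y : Lp ℝ 2 P}
    (hX : MemLp (g ∘ X) 2 P) (hY : MemLp (g ∘ Y) 2 P) :
    ‖hX.toLp _ - hY.toLp _‖ ≤ ε + K * ‖X - Y‖ := by
  have h1 : ‖hX.toLp _ - hY.toLp _‖ ≤ ‖Lp.const 2 P ε + K • |X - Y|‖ := by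
    refine Lp.norm_le_norm_of_ae_le ?_
    filter_upwards [hX.coeFn_toLp, hY.coeFn_toLp, Lp.coeFn_sub X Y, Lp.coeFn_abs (X - Y),
      Lp.coeFn_sub (hX.toLp _) (hY.toLp _), Lp.coeFn_add (Lp.const 2 P ε) (K • |X - Y|),
      Lp.coeFn_smul K |X - Y|, Lp.coeFn_const (p := 2) (μ := P) ε] with ω e1 e2 e3 e4 e5 e6 e7 e8
    rw [e5, e6, Pi.sub_apply, Pi.add_apply, e7, e8, Pi.smul_apply, e4, e3, e1, e2,
      Function.const_apply, smul_eq_mul, Pi.sub_apply, Real.norm_eq_abs, Real.norm_eq_abs]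
    exact (hg _ _).trans (le_abs_self _)
  refine h1.trans ((norm_add_le _ _).trans ?_)
  rw [norm_smul, norm_abs_eq_norm, Real.norm_of_nonneg hK, Lp.norm_const _ _ _ (by simp)]
  simp [abs_of_nonneg hε]

/-- If the process `ξ` with standard Gaussian marginals is continuous in `L²`, then so is
`U ∘ ξ`. -/
lemma continuous_compMeasurePreserving {Ω : Type*} [MeasurableSpace Ω] {P : Measure Ω}
    [IsProbabilityMeasure P] {ξ : ℝ → Lp ℝ 2 P} (hξ : Continuous ξ)
    (hlaw : ∀ t, MeasurePreserving (ξ t) P (gaussianReal 0 1)) (u : Lp ℝ 2 (gaussianReal 0 1)) :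
    Continuous fun t => Lp.compMeasurePreservingₗᵢ ℝ (ξ t) (hlaw t) u := by
  rw [continuous_iff_continuousAt]
  intro t
  rw [Metric.continuousAt_iff']
  intro ε hε
  have hε4 : 0 < ε / 4 := by positivity
  -- Compactly supported continuous functions are dense; composition with a standard Gaussian is
  -- isometric, so the approximation error is the same at all times.
  obtain ⟨g, hgc, hug, hg, hgm⟩ := (Lp.memLp u).exists_hasCompactSupport_eLpNorm_sub_le (by simp)
    (ENNReal.ofReal_pos.2 hε4).ne'
  have hdist : ‖u - hgm.toLp g‖ ≤ ε / 4 := by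
    have h1 : u - hgm.toLp g = ((Lp.memLp u).sub hgm).toLp _ := by
      rw [MemLp.toLp_sub (Lp.memLp u) hgm, Lp.toLp_coeFn]
    rw [h1, Lp.norm_toLp]
    exact ENNReal.toReal_le_of_le_ofReal hε4.le hug
  obtain ⟨K, hK, hgK⟩ := exists_dist_le_add_mul_of_hasCompactSupport hg hgc hε4
  have hcomp : ∀ s, ‖Lp.compMeasurePreservingₗᵢ ℝ (ξ s) (hlaw s) (hgm.toLp g)
      - Lp.compMeasurePreservingₗᵢ ℝ (ξ t) (hlaw t) (hgm.toLp g)‖ ≤ ε / 4 + K * ‖ξ s - ξ t‖ := by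
    intro s
    exact norm_toLp_comp_sub_le hε4.le hK hgK (hgm.comp_measurePreserving (hlaw s))
      (hgm.comp_measurePreserving (hlaw t))
  have hlim : Tendsto (fun s => K * ‖ξ s - ξ t‖) (𝓝 t) (𝓝 0) := by
    have : Continuous fun s => K * ‖ξ s - ξ t‖ := by fun_prop
    simpa using this.tendsto t
  filter_upwards [hlim.eventually_lt_const hε4] with s hs
  rw [dist_eq_norm]
  have e : ∀ r, ‖Lp.compMeasurePreservingₗᵢ ℝ (ξ r) (hlaw r) u
      - Lp.compMeasurePreservingₗᵢ ℝ (ξ r) (hlaw r) (hgm.toLp g)‖ ≤ ε / 4 := by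
    intro r
    rw [← map_sub, LinearIsometry.norm_map]
    exact hdist
  have e1 := e s
  have e2 := e t
  have e3 := hcomp s
  rw [norm_sub_rev] at e2
  have tri := norm_sub_le_norm_sub_add_norm_sub
    (Lp.compMeasurePreservingₗᵢ ℝ (ξ s) (hlaw s) u)
    (Lp.compMeasurePreservingₗᵢ ℝ (ξ s) (hlaw s) (hgm.toLp g))
    (Lp.compMeasurePreservingₗᵢ ℝ (ξ t) (hlaw t) u)
  have tri2 := norm_sub_le_norm_sub_add_norm_sub
    (Lp.compMeasurePreservingₗᵢ ℝ (ξ s) (hlaw s) (hgm.toLp g))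
    (Lp.compMeasurePreservingₗᵢ ℝ (ξ t) (hlaw t) (hgm.toLp g))
    (Lp.compMeasurePreservingₗᵢ ℝ (ξ t) (hlaw t) u)
  linarith

/-! ### Domination and the uniform bounds -/

/-- The dominating function for the decay of the measurable parts. -/
noncomputable def decayBound (D H : ℝ) (m : ℕ) (u : ℝ) : ℝ :=
  if u ≤ 1 then 1 else D ^ m * u ^ (m * (H - 1))

section decayBound

variable {D H : ℝ} {m : ℕ}

lemma decayBound_nonneg (hD : 0 ≤ D) (u : ℝ) : 0 ≤ decayBound D H m u := by
  unfold decayBound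
  split_ifs with h
  · exact zero_le_one
  · exact mul_nonneg (pow_nonneg hD m) (Real.rpow_nonneg (by linarith) _)

/-- The hypothesis on `hStar` is precisely that the exponent $m(H-1)$ lies below $-1$. -/
lemma integrableOn_decayBound (hm : hStar H m < 0) :
    IntegrableOn (decayBound D H m) (Ioi (-1)) := by
  have h1 : IntegrableOn (decayBound D H m) (Ioc (-1) 1) := by
    refine (integrableOn_const (C := (1 : ℝ)) (by simp)).congr_fun (fun u hu => ?_) measurableSet_Ioc
    simp [decayBound, hu.2]
  have h2 : IntegrableOn (decayBound D H m) (Ioi 1) := by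
    have := (integrableOn_Ioi_rpow_iff (s := m * (H - 1)) one_pos).2 (by unfold hStar at hm; linarith)
    refine IntegrableOn.congr_fun (this.const_mul (D ^ m)) (fun u hu => ?_) measurableSet_Ioi
    simp [decayBound, not_le.2 (mem_Ioi.1 hu)]
  have h3 : Ioc (-1 : ℝ) 1 ∪ Ioi 1 = Ioi (-1) := Ioc_union_Ioi_eq_Ioi (by norm_num)
  exact h3 ▸ h1.union h2

lemma preimage_sub_Ioi (k : ℝ) : (fun r : ℝ => r - k) ⁻¹' Ioi (-1) = Ioi (k - 1) := by
  ext r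
  simp only [mem_preimage, mem_Ioi]
  constructor <;> intro h <;> linarith

lemma integrableOn_decayBound_sub (hm : hStar H m < 0) (k : ℝ) :
    IntegrableOn (fun r => decayBound D H m (r - k)) (Ioi (k - 1)) := by
  have h := (measurePreserving_sub_right (volume : Measure ℝ) k).integrableOn_comp_preimage
    (measurableEmbedding_subRight k) (s := Ioi (-1)) (f := decayBound D H m)
  rw [preimage_sub_Ioi] at h
  exact h.2 (integrableOn_decayBound hm)

lemma integral_decayBound_sub (k : ℝ) :
    ∫ r in Ioi (k - 1), decayBound D H m (r - k) = ∫ u in Ioi (-1), decayBound D H m u := by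
  have h := (measurePreserving_sub_right (volume : Measure ℝ) k).setIntegral_preimage_emb
    (measurableEmbedding_subRight k) (decayBound D H m) (Ioi (-1))
  rwa [preimage_sub_Ioi] at h

end decayBound

section FOU

variable {Ω : Type*} [mΩ : MeasurableSpace Ω] {P : Measure Ω} {H σ : ℝ} {B y : ℝ → Ω → ℝ}

lemma IsFractionalBM.exists_pow_norm_starProjection_le (hB : IsFractionalBM P H B)
    (hy : IsStationaryFOU P B σ y) (hH : 1 / 2 < H) (hH1 : H < 1) (m : ℕ) :
    ∃ D : ℝ, 0 ≤ D ∧ ∀ k t : ℝ, 0 ≤ k →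
      ‖(hB.past k).starProjection (hy.vec t)‖ ^ m ≤ decayBound D H m (t - k) := by
  obtain ⟨D, hD, h⟩ := hB.exists_norm_starProjection_le hy hH hH1
  refine ⟨D, hD, fun k t hk => ?_⟩
  unfold decayBound
  split_ifs with htk
  · exact pow_le_one₀ (norm_nonneg _) (hB.norm_starProjection_le_one hy k t)
  · have h1 := pow_le_pow_left₀ (norm_nonneg _) (h k t hk (by linarith)) m
    rwa [mul_pow, ← Real.rpow_mul_natCast (by linarith), mul_comm (H - 1)] at h1

lemma IsFractionalBM.continuous_vec (hB : IsFractionalBM P H B) (hy : IsStationaryFOU P B σ y)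
    (hH : 0 < H) : Continuous hy.vec :=
  (hy.isOUVector hB).continuous hB.hasFBMCovariance hH

/-- The covariances of the measurable parts are integrable, uniformly in the time of conditioning
and in the exponent. -/
lemma IsFractionalBM.exists_integral_inner_pow_le (hB : IsFractionalBM P H B)
    (hy : IsStationaryFOU P B σ y) (hH : 1 / 2 < H) (hH1 : H < 1) {m : ℕ} (hm : hStar H m < 0) :
    ∃ C : ℝ, ∀ k : ℝ, 0 ≤ k → ∀ q : ℕ, m ≤ q →
      IntegrableOn (fun z : ℝ × ℝ => ⟪(hB.past k).starProjection (hy.vec z.1),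
        (hB.past k).starProjection (hy.vec z.2)⟫_ℝ ^ q) (Ioi (k - 1) ×ˢ Ioi (k - 1)) ∧
      ∫ s in Ioi (k - 1), ∫ t in Ioi (k - 1), ⟪(hB.past k).starProjection (hy.vec s),
        (hB.past k).starProjection (hy.vec t)⟫_ℝ ^ q ≤ C := by
  obtain ⟨D, hD, hbound⟩ := hB.exists_pow_norm_starProjection_le hy hH hH1 m
  refine ⟨(∫ u in Ioi (-1), decayBound D H m u) * ∫ u in Ioi (-1), decayBound D H m u,
    fun k hk q hq => ?_⟩
  have hv := hB.continuous_vec hy (by linarith)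
  set Z : ℝ → Lp ℝ 2 P := fun t => (hB.past k).starProjection (hy.vec t) with hZ
  have hZc : Continuous Z := by fun_prop
  have hi := integrableOn_decayBound_sub (D := D) hm k
  have hprod := hi.mul_prod hi
  have hle : ∀ z : ℝ × ℝ, ‖⟪Z z.1, Z z.2⟫_ℝ ^ q‖
      ≤ decayBound D H m (z.1 - k) * decayBound D H m (z.2 - k) := by
    intro z
    rw [norm_pow, Real.norm_eq_abs]
    have h0 := abs_real_inner_le_norm (Z z.1) (Z z.2)
    have h1 : |⟪Z z.1, Z z.2⟫_ℝ| ≤ 1 := h0.trans (mul_le_one₀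
      (hB.norm_starProjection_le_one hy k z.1) (norm_nonneg _)
      (hB.norm_starProjection_le_one hy k z.2))
    -- Covariances have modulus at most $1$, so the exponent $q$ can be lowered to $m$; this gives
    -- uniformity in $q$.
    calc _ ≤ |⟪Z z.1, Z z.2⟫_ℝ| ^ m := pow_le_pow_of_le_one (abs_nonneg _) h1 hq
      _ ≤ (‖Z z.1‖ * ‖Z z.2‖) ^ m := pow_le_pow_left₀ (abs_nonneg _) h0 m
      _ = ‖Z z.1‖ ^ m * ‖Z z.2‖ ^ m := mul_pow _ _ _
      _ ≤ _ := mul_le_mul (hbound k z.1 hk) (hbound k z.2 hk) (by positivity)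
        (decayBound_nonneg hD _)
  have hint : Integrable (fun z : ℝ × ℝ => ⟪Z z.1, Z z.2⟫_ℝ ^ q)
      ((volume.restrict (Ioi (k - 1))).prod (volume.restrict (Ioi (k - 1)))) :=
    hprod.mono' (Continuous.aestronglyMeasurable (by fun_prop)) (ae_of_all _ hle)
  constructor
  · rw [IntegrableOn, Measure.volume_eq_prod, ← Measure.prod_restrict]
    exact hint
  · have h1 := integral_prod _ hint
    simp only at h1
    rw [← h1]
    refine (integral_mono hint hprod fun z => (le_abs_self _).trans (hle z)).trans (le_of_eq ?_)
    rw [integral_prod_mul (fun r => decayBound D H m (r - k)) (fun r => decayBound D H m (r - k)),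
      integral_decayBound_sub]

/-- Ensures that the default value $0$ in `condExpLp` is never used, and identifies it with a
bounded operator applied to $U$. -/
lemma IsFractionalBM.condExpLp_eq [IsProbabilityMeasure P] (hB : IsFractionalBM P H B)
    (hy : IsStationaryFOU P B σ y) {U : ℝ → ℝ} (hU : MemLp U 2 (gaussianReal 0 1)) (k r : ℝ) :
    ∃ _ : MemLp (P[fun ω => U (y r ω) | pastSigma B k]) 2 P,
      condExpLp P (pastSigma B k) (fun ω => U (y r ω))
        = condExpComp (pastSigma_le hB.measurable k) (hB.measurePreserving_vec hy r) (hU.toLp U) := by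
  have hae : (fun ω => U (y r ω)) =ᵐ[P] U ∘ hy.vec r := by
    filter_upwards [(hy.memLp r).coeFn_toLp] with ω hω
    rw [Function.comp_apply, IsStationaryFOU.vec, hω]
  have h1 := (condExpComp_toLp_ae_eq (pastSigma_le hB.measurable k)
    (hB.measurePreserving_vec hy r) hU).trans (condExp_congr_ae hae.symm)
  have h2 : MemLp (P[fun ω => U (y r ω) | pastSigma B k]) 2 P := (memLp_congr_ae h1).1 (Lp.memLp _)
  refine ⟨h2, ?_⟩
  rw [condExpLp, dif_pos h2]
  exact Lp.ext (h2.coeFn_toLp.trans h1.symm)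

lemma inner_hermiteVec_toLp {U : ℝ → ℝ} (hU : MemLp U 2 (gaussianReal 0 1)) {n : ℕ}
    (h : hermiteCoeff U n = 0) : ⟪hermiteVec n, hU.toLp U⟫_ℝ = 0 := by
  have hn : (n.factorial : ℝ) ≠ 0 := by exact_mod_cast n.factorial_ne_zero
  rw [hermiteCoeff, div_eq_zero_iff, or_iff_left hn] at h
  rw [hermiteVec, real_inner_smul_left, inner_toLp_eq_integral]
  simp only [aeval_hermite] at h
  simp only [mul_comm _ (U _), h, mul_zero]

/-- The martingale correctors are bounded in `L²`, uniformly in the time of conditioning. -/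
lemma IsFractionalBM.exists_norm_corrector_le [IsProbabilityMeasure P] (hB : IsFractionalBM P H B)
    (hy : IsStationaryFOU P B σ y) (hH : 1 / 2 < H) (hH1 : H < 1) {m : ℕ} (hm : hStar H m < 0)
    {U : ℝ → ℝ} (hU : MemLp U 2 (gaussianReal 0 1)) (hrank : HasHermiteRank U m) :
    ∃ C : ℝ, ∀ k : ℝ, 0 ≤ k →
      IntegrableOn (fun r => condExpLp P (pastSigma B k) (fun ω => U (y r ω))) (Ioi (k - 1)) ∧
      ‖corrector P B y U k‖ ≤ C := by
  obtain ⟨D, hD, hbound⟩ := hB.exists_pow_norm_starProjection_le hy hH hH1 m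
  refine ⟨(∫ u in Ioi (-1), decayBound D H m u) * ‖hU.toLp U‖, fun k hk => ?_⟩
  have hle : ∀ r, ‖condExpLp P (pastSigma B k) (fun ω => U (y r ω))‖
      ≤ decayBound D H m (r - k) * ‖hU.toLp U‖ := by
    intro r
    obtain ⟨_, h⟩ := hB.condExpLp_eq hy hU k r
    rw [h]
    exact (hB.norm_condExpComp_le hy (by linarith) hk r fun n hn =>
      inner_hermiteVec_toLp hU (hrank.2 n hn)).trans
      (mul_le_mul_of_nonneg_right (hbound k r hk) (norm_nonneg _))
  have hi := (integrableOn_decayBound_sub (D := D) hm k).mul_const ‖hU.toLp U‖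
  -- Continuity in $r$ supplies the strong measurability for the Bochner integral; the norm bound
  -- alone would not.
  have hc : Continuous fun r => condExpLp P (pastSigma B k) (fun ω => U (y r ω)) := by
    have h1 := continuous_compMeasurePreserving (hB.continuous_vec hy (by linarith))
      (hB.measurePreserving_vec hy) (hU.toLp U)
    have h2 : (fun r => condExpLp P (pastSigma B k) (fun ω => U (y r ω)))
        = fun r => ((lpMeas ℝ ℝ (pastSigma B k) 2 P).subtypeL ∘L
          condExpL2 ℝ ℝ (pastSigma_le hB.measurable k))
            (Lp.compMeasurePreservingₗᵢ ℝ (hy.vec r) (hB.measurePreserving_vec hy r)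
              (hU.toLp U)) := by
      ext1 r
      obtain ⟨_, h⟩ := hB.condExpLp_eq hy hU k r
      exact h
    rw [h2]
    exact (ContinuousLinearMap.continuous _).comp h1
  refine ⟨Integrable.mono' hi hc.aestronglyMeasurable (ae_of_all _ hle), ?_⟩
  refine (norm_integral_le_of_norm_le hi (ae_of_all _ hle)).trans (le_of_eq ?_)
  rw [integral_mul_const, integral_decayBound_sub]

end FOU

theorem mainTheorem11 {Ω : Type*} [MeasurableSpace Ω] (P : Measure Ω) [IsProbabilityMeasure P]
    (H : ℝ) (hH : 1 / 2 < H) (hH1 : H < 1) (m : ℕ) (hm : hStar H m < 0)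
    (B : ℝ → Ω → ℝ) (hB : IsFractionalBM P H B)
    (σ : ℝ) (y : ℝ → Ω → ℝ) (hy : IsStationaryFOU P B σ y) :
    -- the local independent decomposition of `y` exists and is almost surely unique
    (∀ k t : ℝ, 0 ≤ k → ∃ ybar ytil : Ω → ℝ,
      IsLocalIndepDecomposition P (pastSigma B k) (y t) ybar ytil ∧
      ∀ ybar' ytil' : Ω → ℝ,
        IsLocalIndepDecomposition P (pastSigma B k) (y t) ybar' ytil' →
        ybar' =ᵐ[P] ybar ∧ ytil' =ᵐ[P] ytil) ∧
    -- the uniform bound for the measurable parts `ybar k t` of `y t`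
    (∀ ybar ytil : ℝ → ℝ → Ω → ℝ,
      (∀ k t : ℝ, 0 ≤ k →
        IsLocalIndepDecomposition P (pastSigma B k) (y t) (ybar k t) (ytil k t)) →
      ∃ C : ℝ, ∀ k : ℝ, 0 ≤ k → ∀ q : ℕ, m ≤ q →
        IntegrableOn (fun z : ℝ × ℝ => (∫ ω, ybar k z.1 ω * ybar k z.2 ω ∂P) ^ q)
          (Ioi (k - 1) ×ˢ Ioi (k - 1)) ∧
        ∫ s in Ioi (k - 1), ∫ t in Ioi (k - 1), (∫ ω, ybar k s ω * ybar k t ω ∂P) ^ q ≤ C) ∧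
    -- the `L²`-boundedness of the martingale correctors
    (∀ U : ℝ → ℝ, MemLp U 2 (gaussianReal 0 1) → HasHermiteRank U m →
      ∃ C : ℝ, ∀ k : ℝ, 0 ≤ k →
        (∀ r, MemLp (P[fun ω => U (y r ω) | pastSigma B k]) 2 P) ∧
        IntegrableOn (fun r => condExpLp P (pastSigma B k) (fun ω => U (y r ω)))
          (Ioi (k - 1)) ∧
        ‖corrector P B y U k‖ ≤ C) := by
  refine ⟨fun k t _ => ⟨_, _, hB.isLocalIndepDecomposition hy k t, fun ybar' ytil' h' => ?_⟩,
    fun ybar ytil h => ?_, fun U hU hrank => ?_⟩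
  · have h1 := hB.ae_eq_starProjection hy h'
    refine ⟨h1, ?_⟩
    filter_upwards [h1, h'.add_eq, (hB.isLocalIndepDecomposition hy k t).add_eq] with ω e1 e2 e3
    rw [e1, e3] at e2
    exact (add_left_cancel e2).symm
  · obtain ⟨C, hC⟩ := hB.exists_integral_inner_pow_le hy hH hH1 hm
    refine ⟨C, fun k hk q hq => ?_⟩
    -- By almost sure uniqueness, any admissible family has the covariances of the projections.
    have e : ∀ s t, ∫ ω, ybar k s ω * ybar k t ω ∂P
        = ⟪(hB.past k).starProjection (hy.vec s), (hB.past k).starProjection (hy.vec t)⟫_ℝ := by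
      intro s t
      rw [← Lp.toLp_coeFn ((hB.past k).starProjection (hy.vec s)) (Lp.memLp _),
        ← Lp.toLp_coeFn ((hB.past k).starProjection (hy.vec t)) (Lp.memLp _),
        inner_toLp_eq_integral]
      refine integral_congr_ae ?_
      filter_upwards [hB.ae_eq_starProjection hy (h k s hk),
        hB.ae_eq_starProjection hy (h k t hk)] with ω e1 e2
      rw [e1, e2]
    simp only [e]
    exact hC k hk q hq
  · obtain ⟨C, hC⟩ := hB.exists_norm_corrector_le hy hH hH1 hm hU hrank
    exact ⟨C, fun k hk => ⟨fun r => (hB.condExpLp_eq hy hU k r).1, hC k hk⟩⟩
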